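/- Let $1\le k\le N$, and let $L$ be the Laplacian of the complete graph on vertices $1,\dots,N+1$ with one indeterminate $a_e$ per undirected edge ($L_{uv}=-a_{uv}$ for $u\ne v$, $L_{uu}=\sum_{v\neq u}a_{uv}$). The first $m=k+1$ vertices are marked. For a matrix $M$ let $M_{U,W}$ be $M$ with the rows in $U$ and the columns in $W$ removed. For $r,c\in[k+1]$ put $M=L_{r,c}$, and consider, for an index $j'\in[k]$, column expansion identity $j'$: $$\det(M)\det(M_{[k],[k]})=\sum_{i=1}^k(-1)^{i+j'}\det(M_{[k]\setminus\{i\},[k]\setminus\{j'\}})\det(M_{\{i\},\{j'\}}).$$ Let $j\ne c$ be the marked vertex indexing column $j'$ of $M$, that is, $j=j'$ if $j'<c$ and $j=j'+1$ if $j'\ge c$. A spanning forest $F$ is compatible with a set partition $P$ of the marked vertices (written $F\sim P$) if there is a bijection between the trees of $F$ and the parts of $P$ such that each marked vertex lies in the tree corresponding to its part; isolated vertices count as trees. Every determinant above is a unique integer combination of the polynomials $\sum_{F\sim P}\prod_{e\in F}a_e$; replacing each of these polynomials by the symbol $P$ and expanding the products turns each side of the identity into a formal integer combination of ordered pairs $AB$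 of set partitions of the marked vertices ($A$ coming from the first and $B$ from the second determinant of each product). Let $L_{r,c}(j')$ be the formal combination obtained from the right-hand side. An $AB$ pair is a pair of set partitions of the marked vertices in which $A$ has $m-1$ parts and $B$ has $2$ parts. Call it a permissible monomial (for $c$ and $j$) if for some marked vertex $\ell\neq j$ (possibly $\ell=c$), $\{j,\ell\}$ is a part of $A$ and all other parts of $A$ are singletons, while in $B$ the vertex $j$ is in one part and $c$ and $\ell$ are both in the other. Then: 1. $L_{c,c}(j')$ consists of exactly one copy of each permissible monomial and nothing else. 2. The forest identity does not depend on the removed row: for every $r\in[k+1]$, $L_{r,c}(j')$ is $(-1)^{r+c}$ times the sum of all permissible monomials, each taken once, and the left-hand side is $(-1)^{r+c}$ times the single monomial $(1,1,\dots,1)(1,2,\dots,m)$, where $(1,1,\dots,1)$ is the partition with one part and $(1,2,\dots,m)$ the partition into singletons. So after cancelling the common sign all choices of $r$ give the same identity. 3. Consequently, for every graph $G$ on the $N+1$ vertices, $$(1,1,\dots,1)\,(1,2,\dots,m)=\sum_{AB\text{ permissible}}A\,B,$$ where each partition $P$ now denotes the spanning forest polynomial $\sum_{F\sim P}\prod_{e\notin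 F}a_e$ of $G$, the sum being over spanning forests $F$ of $G$ and the product over edges of $G$ not in $F$. -/

import Mathlib

open scoped BigOperators

noncomputable section

namespace ColumnExpansion

/-! ### Determinants of submatrices and the column expansion identities -/

section Matrices

variable {R : Type*} [CommRing R] {N : ℕ}

/-- `minor M U W` is `det (M_{U,W})`, where `M_{U,W}` is `M` with the rows in `U` and the columns
in `W` removed, the remaining rows and columns being kept in increasing order.  Only sets `U`, `W`
of the same size are meant (the value is set to `0` otherwise). -/
def minor (M : Matrix (Fin N) (Fin N) R) (U W : Finset (Fin N)) : R :=
  if h : Wᶜ.card = Uᶜ.card then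
    (M.submatrix (Uᶜ.orderEmbOfFin rfl) (Wᶜ.orderEmbOfFin h)).det
  else 0

/-- The initial segment `[k]` of the index set. -/
def initialSeg (k N : ℕ) : Finset (Fin N) := Finset.univ.filter (fun i => i.val < k)

/-- `det (M_{i,j})`: the first factor of the `i`-th term of column expansion identity `j`. -/
def firstFactor (M : Matrix (Fin N) (Fin N) R) {k : ℕ} (h : k ≤ N) (i j : Fin k) : R :=
  minor M {Fin.castLE h i} {Fin.castLE h j}

/-- `det (M_{[k]∖{i},[k]∖{j}})`: the second factor of the `i`-th term of column expansion
identity `j`, which is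
`det M * det (M_{[k],[k]}) = ∑ i, (-1)^(i+j) * det (M_{i,j}) * det (M_{[k]∖{i},[k]∖{j}})`. -/
def secondFactor (M : Matrix (Fin N) (Fin N) R) {k : ℕ} (h : k ≤ N) (i j : Fin k) : R :=
  minor M (initialSeg k N \ {Fin.castLE h i}) (initialSeg k N \ {Fin.castLE h j})

end Matrices

/-! ### Laplacians -/

/-- The Laplacian of a weighted directed graph, `a i j` being the weight of the edge `i → j`. -/
def laplacian {V R : Type*} [Fintype V] [DecidableEq V] [CommRing R] (a : V → V → R) :
    Matrix V V R :=
  Matrix.of fun i j => if i = j then ∑ v ∈ Finset.univ.erase i, a i v else - a i j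

/-- The Laplacian of the complete graph on `Fin n`, with one variable for each undirected edge. -/
def completeLaplacian (n : ℕ) :
    Matrix (Fin n) (Fin n) (MvPolynomial (Sym2 (Fin n)) ℤ) :=
  laplacian fun i j => MvPolynomial.X s(i, j)

/-- `L_{r,c}`: the Laplacian of the complete graph on `N + 1` vertices, of which the first `k + 1`
are marked, with the row of the marked vertex `r` and the column of the marked vertex `c`
removed. -/
def reducedLaplacian {k N : ℕ} (h : k ≤ N) (r c : Fin (k + 1)) :
    Matrix (Fin N) (Fin N) (MvPolynomial (Sym2 (Fin (N + 1))) ℤ) :=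
  (completeLaplacian (N + 1)).submatrix
    (Fin.castLE (Nat.succ_le_succ h) r).succAbove (Fin.castLE (Nat.succ_le_succ h) c).succAbove

/-! ### Set partitions of the marked vertices and spanning forest polynomials -/

/-- Set partitions of the set of `m` marked vertices. -/
abbrev MarkedPartition (m : ℕ) := Finpartition (Finset.univ : Finset (Fin m))

/-- A set `F` of edges on the vertex set `Fin n` (whose first `m` vertices are marked) is a spanning
forest compatible with `P`: it is acyclic, and there is a bijection between the parts of `P` and
the trees (the connected components, isolated vertices included) such that each marked vertex lies
in the tree that corresponds to its part. -/
def IsCompatibleForest {m n : ℕ} (h : m ≤ n) (P : MarkedPartition m)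
    (F : Finset (Sym2 (Fin n))) : Prop :=
  (SimpleGraph.fromEdgeSet (F : Set (Sym2 (Fin n)))).IsAcyclic ∧
    ∃ φ : {p // p ∈ P.parts} ≃
        (SimpleGraph.fromEdgeSet (F : Set (Sym2 (Fin n)))).ConnectedComponent,
      ∀ p : {p // p ∈ P.parts}, ∀ v ∈ p.1,
        (SimpleGraph.fromEdgeSet (F : Set (Sym2 (Fin n)))).connectedComponentMk
          (Fin.castLE h v) = φ p

open Classical in
/-- The spanning forests of `G` compatible with `P`, as sets of edges. -/
def compatibleForests {m n : ℕ} (h : m ≤ n) (G : SimpleGraph (Fin n)) (P : MarkedPartition m) :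
    Finset (Finset (Sym2 (Fin n))) :=
  G.edgeFinset.powerset.filter (IsCompatibleForest h P)

open Classical in
/-- The spanning forest polynomial `∑_{F ∼ P} ∏_{e ∉ F} a_e` of `G` and `P`. -/
def spanningForestPoly {m n : ℕ} (h : m ≤ n) (G : SimpleGraph (Fin n)) (P : MarkedPartition m) :
    MvPolynomial (Sym2 (Fin n)) ℤ :=
  ∑ F ∈ compatibleForests h G P, ∏ e ∈ G.edgeFinset \ F, MvPolynomial.X e

/-- The polynomial `∑_{F ∼ P} ∏_{e ∈ F} a_e` of the complete graph.  This is the form in which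
spanning forests appear in minors of the Laplacian. -/
def forestSum {m n : ℕ} (h : m ≤ n) (P : MarkedPartition m) : MvPolynomial (Sym2 (Fin n)) ℤ :=
  ∑ F ∈ compatibleForests h (⊤ : SimpleGraph (Fin n)) P, ∏ e ∈ F, MvPolynomial.X e

/-- The formal integer combination `α` of set partitions of the marked vertices becomes the
polynomial `p` when each set partition is replaced by its sum of spanning forests. -/
def IsForestExpansion {m n : ℕ} (h : m ≤ n) (α : MarkedPartition m → ℤ)
    (p : MvPolynomial (Sym2 (Fin n)) ℤ) : Prop :=
  p = ∑ P, MvPolynomial.C (α P) * forestSum h P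

/-! ### The two sides of the spanning forest identities, as formal sums of pairs of partitions -/

/-- Formal integer combinations of (ordered) pairs of set partitions of `m` marked vertices; the
value at a pair is its coefficient. -/
abbrev PairSum (m : ℕ) := MarkedPartition m × MarkedPartition m → ℤ

/-- The formal bilinear product of two formal combinations of set partitions. -/
def pairProduct {m : ℕ} (α β : MarkedPartition m → ℤ) : PairSum m :=
  fun AB => α AB.1 * β AB.2

/-- `T` is the left hand side `det M * det (M_{[k],[k]})`, `M = L_{r,c}`, written in terms of pairs
of set partitions by expanding each determinant in spanning forests. -/
def IsLeftSide {k N : ℕ} (h : k ≤ N) (r c : Fin (k + 1)) (T : PairSum (k + 1)) : Prop :=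
  ∃ α β : MarkedPartition (k + 1) → ℤ,
    IsForestExpansion (Nat.succ_le_succ h) α (reducedLaplacian h r c).det ∧
    IsForestExpansion (Nat.succ_le_succ h) β
      (minor (reducedLaplacian h r c) (initialSeg k N) (initialSeg k N)) ∧
    T = pairProduct α β

/-- `S` is the right hand side `L_{r,c}(j)` of column expansion identity `j` for `M = L_{r,c}`,
written in terms of pairs of set partitions by expanding each determinant in spanning forests: in
each term the `A` partitions come from `det (M_{[k]∖{i},[k]∖{j}})` and the `B` partitions from
`det (M_{i,j})`. -/
def IsRightSide {k N : ℕ} (h : k ≤ N) (r c : Fin (k + 1)) (j : Fin k) (S : PairSum (k + 1)) :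
    Prop :=
  ∃ α β : Fin k → MarkedPartition (k + 1) → ℤ,
    (∀ i, IsForestExpansion (Nat.succ_le_succ h) (α i)
      (secondFactor (reducedLaplacian h r c) h i j)) ∧
    (∀ i, IsForestExpansion (Nat.succ_le_succ h) (β i)
      (firstFactor (reducedLaplacian h r c) h i j)) ∧
    S = ∑ i : Fin k, (-1 : ℤ) ^ (i.val + j.val) • pairProduct (α i) (β i)

/-! ### Permissible monomials -/

/-- An `AB` pair on `m` marked vertices: `A` has `m - 1` parts and `B` has `2` parts. -/
def IsABPair {m : ℕ} (AB : MarkedPartition m × MarkedPartition m) : Prop :=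
  AB.1.parts.card + 1 = m ∧ AB.2.parts.card = 2

/-- Permissible monomials for the marked vertices `c` and `j`. -/
def IsPermissible {m : ℕ} (c j : Fin m) (AB : MarkedPartition m × MarkedPartition m) : Prop :=
  IsABPair AB ∧
    ∃ l : Fin m, l ≠ j ∧
      ({j, l} ∈ AB.1.parts ∧ ∀ v, v ≠ j → v ≠ l → {v} ∈ AB.1.parts) ∧
      ∃ p ∈ AB.2.parts, ∃ q ∈ AB.2.parts, p ≠ q ∧ j ∈ p ∧ c ∈ q ∧ l ∈ q

open Classical in
/-- The formal sum of one copy of each permissible monomial. -/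
def permissibleSum {m : ℕ} (c j : Fin m) : PairSum m :=
  fun AB => if IsPermissible c j AB then 1 else 0

/-- The partition `(1,1,…,1)` with a single part. -/
def onePart (k : ℕ) : MarkedPartition (k + 1) :=
  Finpartition.indiscrete (Finset.univ_nonempty.ne_empty)

/-- The partition `(1,2,…,m)` into singletons. -/
def allSingletons (m : ℕ) : MarkedPartition m := ⊥

open Classical in
/-- The single monomial `(1,1,…,1)(1,2,…,m)`. -/
def leftMonomial (k : ℕ) : PairSum (k + 1) :=
  fun AB => if AB = (onePart k, allSingletons (k + 1)) then 1 else 0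

end ColumnExpansion

end

/-!
Pinning the rows of a set `Q` of marked vertices in the Laplacian, that is, replacing them by rows
of the identity matrix, leaves a determinant that is multilinear in the remaining rows
`∑ t, a v t • (e_v - e_t)`. Its expansion runs over the maps `f` fixing `Q`, and the term of `f`
vanishes unless every orbit ends in `Q`, that is, unless `f` encodes a forest rooted at `Q`; further
replacing the pinned row `x ∈ Q` by `e_z` keeps the forests in which `z` hangs from `x`. Grouped by
the partition they induce on the marked vertices, these are the forests compatible with a partition
`P` having `Q` as a transversal and `x`, `z` in one part. The polynomials of the partitions are
linearly independent because every partition is induced by some forest and every forest induces at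
most one partition.

With `u` the marked vertex of row `i` and `j` that of column `j'`, the second factor of the `i`-th
term is thus, up to sign, the sum over `A` having `univ.erase u` as a transversal and `u`, `j` in
one part, and the first factor the signed sum over `B` separating `r` from `u`, and `c` from `j`. A
partition `A` that occurs consists of a pair `{j, l}` and singletons, and only `u = j` and `u = l`
contribute; comparing these two terms for a two-part `B` leaves exactly the permissible monomials.

The identity for a graph `G` follows by substituting `a_e⁻¹` for the edges of `G` and `0` for the
other edges.
-/

noncomputable section

namespace ColumnExpansion

/-! ### Determinants with pinned rows -/

section PinnedRows

open Matrix

variable {R : Type*} [CommRing R] {V : Type*} [DecidableEq V]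

/-- The matrix `A` with each row in `Q` replaced by the corresponding row of the identity matrix.
Its determinant is the principal minor of `A` away from `Q`, but no reindexing is involved. -/
def pinRows (A : Matrix V V R) (Q : Finset V) : Matrix V V R :=
  Matrix.of fun v => if v ∈ Q then Pi.single v 1 else A v

theorem pinRows_of_mem (A : Matrix V V R) {Q : Finset V} {v : V} (hv : v ∈ Q) :
    pinRows A Q v = Pi.single v 1 := if_pos hv

theorem pinRows_of_notMem (A : Matrix V V R) {Q : Finset V} {v : V} (hv : v ∉ Q) :
    pinRows A Q v = A v := if_neg hv

theorem pinRows_erase_of_ne (A : Matrix V V R) (Q : Finset V) {v x : V} (hv : v ≠ x) :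
    pinRows A (Q.erase x) v = pinRows A Q v :=
  if_congr (by rw [Finset.mem_erase, and_iff_right hv]) rfl rfl

theorem pinRows_erase (A : Matrix V V R) (Q : Finset V) (x : V) :
    pinRows A (Q.erase x) = (pinRows A Q).updateRow x (A x) := by
  refine funext fun v => ?_
  obtain rfl | hvx := eq_or_ne v x
  · rw [pinRows_of_notMem A (Finset.notMem_erase v Q), updateRow_self]
  · rw [updateRow_ne hvx, pinRows_erase_of_ne A Q hvx]

theorem pinRows_insert (A : Matrix V V R) (Q : Finset V) (r : V) :
    pinRows A (insert r Q) = (pinRows A Q).updateRow r (Pi.single r 1) := by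
  refine funext fun v => ?_
  obtain rfl | hvr := eq_or_ne v r
  · rw [pinRows_of_mem A (Finset.mem_insert_self v Q), updateRow_self]
  · rw [updateRow_ne hvr]
    exact if_congr (by rw [Finset.mem_insert, or_iff_right hvr]) rfl rfl

theorem pinRows_singleton (A : Matrix V V R) (r : V) :
    pinRows A {r} = A.updateRow r (Pi.single r 1) := by
  have hempty : pinRows A ∅ = A := funext fun v => pinRows_of_notMem A (Finset.notMem_empty v)
  rw [← insert_empty_eq, pinRows_insert, hempty]

theorem pinRows_updateRow_single_self (A : Matrix V V R) {Q : Finset V} {v : V} (hv : v ∈ Q) :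
    (pinRows A Q).updateRow v (Pi.single v 1) = pinRows A Q := by
  rw [← pinRows_of_mem A hv, updateRow_eq_self]

variable [Fintype V]

theorem det_eq_zero_of_forall_sum_eq_zero [Nonempty V] {A : Matrix V V R}
    (hA : ∀ v, ∑ w, A v w = 0) : A.det = 0 := by
  obtain ⟨v⟩ := ‹Nonempty V›
  have hA1 : A *ᵥ 1 = 0 := funext fun v => by simpa [mulVec, dotProduct] using hA v
  have h := congrFun (congrArg (A.adjugate *ᵥ ·) hA1) v
  simpa [mulVec_mulVec, adjugate_mul, smul_mulVec] using h

/-- If `pᶜ` is a nonempty set of indices whose rows are supported on `pᶜ` and have zero sum, then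
the block of `A` on `pᶜ` is singular, and so is `A`. -/
theorem det_eq_zero_of_singular_block {A : Matrix V V R} {p : V → Prop} (hp : ∃ v, ¬ p v)
    (hblock : ∀ v, ¬ p v → ∀ w, p w → A v w = 0) (hsum : ∀ v, ¬ p v → ∑ w, A v w = 0) :
    A.det = 0 := by
  classical
  obtain ⟨v₀, hv₀⟩ := hp
  have : Nonempty {v // ¬ p v} := ⟨⟨v₀, hv₀⟩⟩
  rw [twoBlockTriangular_det A p hblock]
  refine mul_eq_zero_of_right _ (det_eq_zero_of_forall_sum_eq_zero fun v => ?_)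
  rw [← hsum v v.2, ← Fintype.sum_subtype_add_sum_subtype p (A v),
    Finset.sum_eq_zero fun (w : {w // p w}) _ => hblock v v.2 w w.2, zero_add]
  rfl

theorem det_updateRow_sub (A : Matrix V V R) (i : V) (u v : V → R) :
    (A.updateRow i (u - v)).det = (A.updateRow i u).det - (A.updateRow i v).det :=
  (detRowAlternating : (V → R) [⋀^V]→ₗ[R] R).map_update_sub A i u v

theorem det_updateRow_eq_dotProduct (A : Matrix V V R) (y : V) (b : V → R) :
    (A.updateRow y b).det = b ⬝ᵥ fun t => A.adjugate t y := by
  rw [← cramer_transpose_apply, cramer_eq_adjugate_mulVec, ← adjugate_transpose]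
  exact dotProduct_comm _ _

theorem det_mul_det_updateRow_single (A B : Matrix V V R) (y : V) :
    A.det * (B.updateRow y (Pi.single y 1)).det =
      ∑ v, (A.updateRow v (Pi.single y 1)).det * (B.updateRow y (A v)).det := by
  have h : (A.adjugate * (A * B.adjugate)) y y = A.det * B.adjugate y y := by
    rw [← Matrix.mul_assoc, adjugate_mul, smul_mul, Matrix.one_mul, Matrix.smul_apply,
      smul_eq_mul]
  rw [← adjugate_apply, ← h, mul_apply]
  refine Finset.sum_congr rfl fun v _ => ?_
  rw [adjugate_apply, det_updateRow_eq_dotProduct B]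
  rfl

theorem det_submatrix_eq_det_pinRows {ι : Type*} [Fintype ι] [DecidableEq ι] (A : Matrix V V R)
    {e : ι → V} (he : Function.Injective e) {Q : Finset V} (hQ : ∀ v, v ∉ Q ↔ v ∈ Set.range e) :
    (A.submatrix e e).det = (pinRows A Q).det := by
  let e' : ι ≃ {v // v ∉ Q} :=
    (Equiv.ofInjective e he).trans (Equiv.subtypeEquivRight fun v => (hQ v).symm)
  have hpinned : (pinRows A Q).toSquareBlockProp (¬ · ∉ Q) = 1 := by
    ext v w
    simp [toSquareBlockProp, pinRows_of_mem A (not_not.1 v.2), Matrix.one_apply, Pi.single_apply,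
      Subtype.ext_iff, eq_comm]
  have hrest : A.submatrix e e = ((pinRows A Q).toSquareBlockProp (· ∉ Q)).submatrix e' e' := by
    ext x y
    exact (congrFun (pinRows_of_notMem A (e' x).2) (e y)).symm
  rw [twoBlockTriangular_det (pinRows A Q) (· ∉ Q), hpinned, det_one, mul_one, hrest,
    det_submatrix_equiv_self]
  intro v hv w hw
  have hvQ := not_not.1 hv
  rw [pinRows_of_mem A hvQ, Pi.single_eq_of_ne (ne_of_mem_of_not_mem hvQ hw).symm]

theorem det_submatrix_swap {ι : Type*} [Fintype ι] [DecidableEq ι] (A : Matrix V V R)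
    {e : ι → V} (he : Function.Injective e) {Q : Finset V} {x y : V} (hx : x ∈ Q)
    (hQ : ∀ v, v ∉ Q.erase y ↔ v ∈ Set.range e) :
    (A.submatrix (Equiv.swap x y ∘ e) e).det = ((pinRows A Q).updateRow y (A x)).det := by
  have hrow : pinRows (A.submatrix (Equiv.swap x y) id) (Q.erase y) =
      (pinRows A Q).updateRow y (A x) := by
    refine funext fun v => ?_
    by_cases hvy : v = y
    · subst hvy
      rw [pinRows_of_notMem _ (Finset.notMem_erase v Q), updateRow_self]
      exact congrArg A (Equiv.swap_apply_right x v)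
    rw [updateRow_ne hvy, pinRows_erase_of_ne _ Q hvy]
    by_cases hv : v ∈ Q
    · rw [pinRows_of_mem A hv, pinRows_of_mem _ hv]
    · rw [pinRows_of_notMem A hv, pinRows_of_notMem _ hv]
      exact congrArg A (Equiv.swap_apply_of_ne_of_ne (ne_of_mem_of_not_mem hx hv).symm hvy)
  rw [← hrow, ← det_submatrix_eq_det_pinRows _ he hQ]
  rfl

theorem det_pinRows_updateRow_of_ne (A : Matrix V V R) {Q : Finset V} {x y : V} (hx : x ∈ Q)
    (hxy : x ≠ y) :
    ((pinRows A Q).updateRow y (A x)).det =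
      -((pinRows A (Q.erase x)).updateRow y (Pi.single x 1)).det := by
  have hswap : (pinRows A (Q.erase x)).updateRow y (Pi.single x 1) =
      ((pinRows A Q).updateRow y (A x)).submatrix (Equiv.swap x y) id := by
    refine funext fun v => ?_
    obtain rfl | hvy := eq_or_ne v y
    · refine (updateRow_self ..).trans (?_ : _ = (pinRows A Q).updateRow v (A x) _)
      rw [Equiv.swap_apply_right, updateRow_ne hxy, pinRows_of_mem A hx]
    refine (updateRow_ne hvy).trans (?_ : _ = (pinRows A Q).updateRow y (A x) _)
    obtain rfl | hvx := eq_or_ne v x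
    · rw [Equiv.swap_apply_left, updateRow_self, pinRows_of_notMem A (Finset.notMem_erase v Q)]
    · rw [Equiv.swap_apply_of_ne_of_ne hvx hvy, updateRow_ne hvy, pinRows_erase_of_ne A Q hvx]
  rw [hswap, det_permute, Equiv.Perm.sign_swap hxy]
  simp

end PinnedRows

/-! ### The column expansion identities -/

section Minors

open Matrix

variable {R : Type*} [CommRing R] {k n N : ℕ}

theorem minor_eq (M : Matrix (Fin N) (Fin N) R) {U W : Finset (Fin N)} (hU : Uᶜ.card = n)
    (hW : Wᶜ.card = n) :
    minor M U W = (M.submatrix (Uᶜ.orderEmbOfFin hU) (Wᶜ.orderEmbOfFin hW)).det := by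
  subst hU
  rw [minor, dif_pos hW]

theorem notMem_iff_mem_range_orderEmbOfFin_compl {U : Finset (Fin N)} (hU : Uᶜ.card = n)
    (v : Fin N) : v ∉ U ↔ v ∈ Set.range (Uᶜ.orderEmbOfFin hU) := by
  rw [Finset.range_orderEmbOfFin, Finset.mem_coe, Finset.mem_compl]

theorem minor_self (M : Matrix (Fin N) (Fin N) R) (U : Finset (Fin N)) :
    minor M U U = (pinRows M U).det := by
  rw [minor_eq M rfl rfl, det_submatrix_eq_det_pinRows M (RelEmbedding.injective _)
    (notMem_iff_mem_range_orderEmbOfFin_compl rfl)]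

theorem det_submatrix_succAbove (A : Matrix (Fin (N + 1)) (Fin (N + 1)) R) (r c : Fin (N + 1)) :
    (A.submatrix r.succAbove c.succAbove).det =
      (-1) ^ (r.val + c.val) * (A.updateRow r (Pi.single c 1)).det := by
  rw [← adjugate_apply, adjugate_fin_succ_eq_det_submatrix, ← mul_assoc, ← mul_pow]
  simp

theorem minor_singleton (M : Matrix (Fin N) (Fin N) R) (i j : Fin N) :
    minor M {i} {j} = (-1) ^ (i.val + j.val) * (M.updateRow i (Pi.single j 1)).det := by
  obtain _ | N := N
  · exact i.elim0
  have hcard (i : Fin (N + 1)) : ({i} : Finset (Fin (N + 1)))ᶜ.card = N := by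
    simp [Finset.card_compl]
  have hemb (i : Fin (N + 1)) :
      i.succAbove = ({i} : Finset (Fin (N + 1)))ᶜ.orderEmbOfFin (hcard i) :=
    Finset.orderEmbOfFin_unique (hcard i) (fun x => by simp [Fin.succAbove_ne])
      (Fin.strictMono_succAbove i)
  rw [minor_eq M (hcard i) (hcard j), ← hemb, ← hemb, det_submatrix_succAbove]

theorem mem_initialSeg {v : Fin N} : v ∈ initialSeg k N ↔ v.val < k := by
  simp [initialSeg]

theorem castLE_mem_initialSeg (h : k ≤ N) (i : Fin k) : Fin.castLE h i ∈ initialSeg k N :=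
  mem_initialSeg.2 i.isLt

theorem mem_compl_initialSeg_sdiff (h : k ≤ N) (i : Fin k) {v : Fin N} :
    v ∈ (initialSeg k N \ {Fin.castLE h i})ᶜ ↔ v = Fin.castLE h i ∨ k ≤ v.val := by
  rw [Finset.mem_compl, Finset.mem_sdiff, mem_initialSeg, Finset.mem_singleton]
  by_cases h1 : v = Fin.castLE h i <;> simp [h1]

theorem swap_castLE_apply_of_le (h : k ≤ N) (i j : Fin k) {v : Fin N} (hv : k ≤ v.val) :
    Equiv.swap (Fin.castLE h i) (Fin.castLE h j) v = v :=
  have hne (i : Fin k) : v ≠ Fin.castLE h i := fun hvi =>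
    absurd i.isLt (not_lt.2 (hvi ▸ hv : k ≤ (Fin.castLE h i).val))
  Equiv.swap_apply_of_ne_of_ne (hne i) (hne j)

theorem card_compl_initialSeg_sdiff (h : k ≤ N) (i j : Fin k) :
    (initialSeg k N \ {Fin.castLE h i})ᶜ.card = (initialSeg k N \ {Fin.castLE h j})ᶜ.card := by
  simp only [Finset.card_compl, Finset.card_sdiff_of_subset
    (Finset.singleton_subset_iff.2 (castLE_mem_initialSeg h _)), Finset.card_singleton]

theorem orderEmbOfFin_compl_initialSeg_sdiff (h : k ≤ N) (i j : Fin k) :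
    ((initialSeg k N \ {Fin.castLE h i})ᶜ.orderEmbOfFin (card_compl_initialSeg_sdiff h i j) :
        _ → Fin N) =
      Equiv.swap (Fin.castLE h i) (Fin.castLE h j) ∘
        (initialSeg k N \ {Fin.castLE h j})ᶜ.orderEmbOfFin rfl := by
  set e := (initialSeg k N \ {Fin.castLE h j})ᶜ.orderEmbOfFin rfl
  have hmem x : e x = Fin.castLE h j ∨ k ≤ (e x).val :=
    (mem_compl_initialSeg_sdiff h j).1 (Finset.orderEmbOfFin_mem _ rfl x)
  refine (Finset.orderEmbOfFin_unique _ (fun x => ?_) fun a b hab => ?_).symm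
  · rw [mem_compl_initialSeg_sdiff, Function.comp_apply]
    rcases hmem x with hx | hx
    · exact Or.inl (by rw [hx, Equiv.swap_apply_right])
    · exact Or.inr (by rwa [swap_castLE_apply_of_le h i j hx])
  have hlt : e a < e b := e.strictMono hab
  -- the entry in `[k]`, if any, comes first in `e`
  have hb : k ≤ (e b).val := (hmem b).resolve_left fun hb => by
    rcases hmem a with ha | ha
    · exact hlt.ne (ha.trans hb.symm)
    · exact absurd (hlt.trans_eq hb) (not_lt.2 (j.isLt.le.trans ha))
  rw [Function.comp_apply, Function.comp_apply, swap_castLE_apply_of_le h i j hb]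
  rcases hmem a with ha | ha
  · rw [ha, Equiv.swap_apply_right]
    exact i.isLt.trans_le hb
  · rwa [swap_castLE_apply_of_le h i j ha]

theorem secondFactor_eq_det_submatrix (M : Matrix (Fin N) (Fin N) R) (h : k ≤ N) (i j : Fin k) :
    secondFactor M h i j =
      (M.submatrix
        (Equiv.swap (Fin.castLE h i) (Fin.castLE h j) ∘
          (initialSeg k N \ {Fin.castLE h j})ᶜ.orderEmbOfFin rfl)
        ((initialSeg k N \ {Fin.castLE h j})ᶜ.orderEmbOfFin rfl)).det := by
  rw [secondFactor, minor_eq M (card_compl_initialSeg_sdiff h i j) rfl,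
    orderEmbOfFin_compl_initialSeg_sdiff]

theorem secondFactor_eq (M : Matrix (Fin N) (Fin N) R) (h : k ≤ N) (i j : Fin k) :
    secondFactor M h i j =
      ((pinRows M (initialSeg k N)).updateRow (Fin.castLE h j) (M (Fin.castLE h i))).det := by
  rw [secondFactor_eq_det_submatrix, det_submatrix_swap M (RelEmbedding.injective _)
    (castLE_mem_initialSeg h i)]
  rw [Finset.erase_eq]
  exact notMem_iff_mem_range_orderEmbOfFin_compl rfl

theorem det_mul_minor_initialSeg (M : Matrix (Fin N) (Fin N) R) (h : k ≤ N) (j : Fin k) :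
    M.det * minor M (initialSeg k N) (initialSeg k N) =
      ∑ i, (-1) ^ (i.val + j.val) * (secondFactor M h i j * firstFactor M h i j) := by
  have hunpinned (v : Fin N) (hv : v ∉ Finset.univ.map (Fin.castLEEmb h)) :
      (M.updateRow v (Pi.single (Fin.castLE h j) 1)).det *
        ((pinRows M (initialSeg k N)).updateRow (Fin.castLE h j) (M v)).det = 0 := by
    have hvk : v ∉ initialSeg k N := fun hvk =>
      hv (Finset.mem_map.2 ⟨⟨v, mem_initialSeg.1 hvk⟩, Finset.mem_univ _, rfl⟩)
    rw [← pinRows_of_notMem M hvk, det_updateRow_eq_zero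
      (ne_of_mem_of_not_mem (castLE_mem_initialSeg h j) hvk).symm, mul_zero]
  rw [minor_self, ← pinRows_updateRow_single_self M (castLE_mem_initialSeg h j),
    det_mul_det_updateRow_single,
    ← Finset.sum_subset (Finset.subset_univ _) fun v _ => hunpinned v, Finset.sum_map]
  refine Finset.sum_congr rfl fun i _ => ?_
  have hsign : (-1 : R) ^ (i.val + j.val) * (-1) ^ (i.val + j.val) = 1 := by
    rw [← mul_pow, neg_one_mul, neg_neg, one_pow]
  rw [secondFactor_eq, firstFactor, minor_singleton]
  simp only [Fin.castLEEmb_apply, Fin.val_castLE]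
  rw [mul_left_comm ((-1 : R) ^ _), ← mul_assoc ((-1 : R) ^ _), hsign, one_mul, mul_comm]

end Minors

/-! ### Minors of a Laplacian as sums over rooted maps -/

section RootedMaps

open Matrix

variable {V : Type*}

/-- A self-map whose orbits all end in fixed points, those in `Q`.  When `V` is finite these maps
encode the forests rooted at `Q`: `f` moves each vertex one step towards its root. -/
structure IsRootedMap (Q : Finset V) (f : V → V) : Prop where
  map_root : ∀ q ∈ Q, f q = q
  exists_iterate_mem : ∀ v, ∃ n, f^[n] v ∈ Q

namespace IsRootedMap

variable {Q : Finset V} {f : V → V}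

theorem exists_depth (hf : IsRootedMap Q f) : ∃ d : V → ℕ, ∀ v ∉ Q, d (f v) < d v := by
  classical
  refine ⟨fun v => Nat.find (hf.exists_iterate_mem v), fun v hv => ?_⟩
  have hpos : Nat.find (hf.exists_iterate_mem v) ≠ 0 := fun h => hv ((Nat.find_eq_zero _).1 h)
  obtain ⟨n, hn⟩ := Nat.exists_eq_succ_of_ne_zero hpos
  have hmem := Nat.find_spec (hf.exists_iterate_mem v)
  rw [hn] at hmem
  exact (Nat.lt_succ_of_le (Nat.find_min' _ hmem)).trans_eq hn.symm

theorem iterate_map_ne (hf : IsRootedMap Q f) {v : V} (hv : v ∉ Q) (n : ℕ) : f^[n] (f v) ≠ v := by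
  obtain ⟨d, hd⟩ := hf.exists_depth
  have hle : d (f^[n] (f v)) ≤ d (f v) := by
    induction n with
    | zero => exact le_rfl
    | succ n ih =>
      rw [Function.iterate_succ_apply']
      by_cases hn : f^[n] (f v) ∈ Q
      · rwa [hf.map_root _ hn]
      · exact (hd _ hn).le.trans ih
  intro h
  rw [h] at hle
  exact (hd v hv).not_ge hle

theorem map_ne (hf : IsRootedMap Q f) {v : V} (hv : v ∉ Q) : f v ≠ v := hf.iterate_map_ne hv 0

theorem exists_iterate_eq_iff_eq (hf : IsRootedMap Q f) {q : V} (hq : q ∈ Q) (x : V) :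
    (∃ n, f^[n] q = x) ↔ q = x := by
  simp only [Function.iterate_fixed (hf.map_root q hq), exists_const]

theorem exists_iterate_map_eq_iff (hf : IsRootedMap Q f) {x : V} (hx : x ∈ Q) (v : V) :
    (∃ n, f^[n] (f v) = x) ↔ ∃ n, f^[n] v = x := by
  constructor
  · rintro ⟨n, hn⟩
    exact ⟨n + 1, hn⟩
  · rintro ⟨_ | n, hn⟩
    · obtain rfl : v = x := hn
      exact ⟨0, hf.map_root v hx⟩
    · exact ⟨n, hn⟩

end IsRootedMap

variable [DecidableEq V] (R : Type*) [CommRing R]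

/-- The Laplacian of the functional digraph with edges `v → f v`, with the rows in `Q` pinned. -/
def functionalMatrix (Q : Finset V) (f : V → V) : Matrix V V R :=
  pinRows (Matrix.of fun v => Pi.single v 1 - Pi.single (f v) 1) Q

theorem functionalMatrix_of_mem {Q : Finset V} (f : V → V) {v : V} (hv : v ∈ Q) :
    functionalMatrix R Q f v = Pi.single v 1 := pinRows_of_mem _ hv

theorem functionalMatrix_of_notMem {Q : Finset V} (f : V → V) {v : V} (hv : v ∉ Q) :
    functionalMatrix R Q f v = Pi.single v 1 - Pi.single (f v) 1 := pinRows_of_notMem _ hv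

variable [Fintype V] {Q : Finset V} {f : V → V} {x : V}

theorem det_functionalMatrix (hf : IsRootedMap Q f) : (functionalMatrix R Q f).det = 1 := by
  obtain ⟨d, hd⟩ := hf.exists_depth
  have hone {v w : V} (hvw : d v ≤ d w) :
      functionalMatrix R Q f v w = (1 : Matrix V V R) v w := by
    rw [Matrix.one_eq_pi_single]
    by_cases hv : v ∈ Q
    · rw [functionalMatrix_of_mem R f hv]
    · have hwf : w ≠ f v := fun h => ((hd v hv).trans_le hvw).ne (congrArg d h.symm)
      rw [functionalMatrix_of_notMem R f hv, Pi.sub_apply, Pi.single_eq_of_ne hwf, sub_zero]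
  have hblock : (functionalMatrix R Q f).BlockTriangular (OrderDual.toDual ∘ d) := by
    intro v w hvw
    replace hvw : d v < d w := hvw
    rw [hone hvw.le, Matrix.one_apply_ne (ne_of_apply_ne d hvw.ne)]
  rw [hblock.det]
  refine Finset.prod_eq_one fun a _ => (congrArg Matrix.det ?_).trans det_one
  ext v w
  have hvw : d v = d w := OrderDual.toDual.injective (v.2.trans w.2.symm)
  refine (hone hvw.le).trans ?_
  rw [Matrix.one_apply, Matrix.one_apply]
  exact if_congr Subtype.ext_iff.symm rfl rfl

open Classical in
theorem det_functionalMatrix_updateRow (hf : IsRootedMap Q f) (hx : x ∈ Q) (z : V) :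
    ((functionalMatrix R Q f).updateRow x (Pi.single z 1)).det =
      if ∃ n, f^[n] z = x then 1 else 0 := by
  set E := functionalMatrix R Q f with hE
  let reaches : V → R := fun v => if ∃ n, f^[n] v = x then 1 else 0
  have hreaches : E *ᵥ reaches = Pi.single x 1 := by
    refine funext fun v => (?_ : E v ⬝ᵥ reaches = _)
    by_cases hv : v ∈ Q
    · rw [hE, functionalMatrix_of_mem R f hv, single_one_dotProduct]
      simp only [reaches, hf.exists_iterate_eq_iff_eq hv, Pi.single_apply]
    · have hvx : v ≠ x := (ne_of_mem_of_not_mem hx hv).symm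
      rw [hE, functionalMatrix_of_notMem R f hv, sub_dotProduct, single_one_dotProduct,
        single_one_dotProduct, Pi.single_eq_of_ne hvx]
      simp only [reaches, hf.exists_iterate_map_eq_iff hx, sub_self]
  have hinv : E.adjugate *ᵥ Pi.single x 1 = reaches := by
    rw [← hreaches, mulVec_mulVec, adjugate_mul, hE, det_functionalMatrix R hf, one_smul,
      one_mulVec]
  rw [← adjugate_apply, ← col_apply E.adjugate, ← mulVec_single_one, hinv]

theorem det_functionalMatrix_updateRow_eq_zero (hf : ¬ ∀ v, ∃ n, f^[n] v ∈ Q) (hx : x ∈ Q)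
    (b : V → R) : ((functionalMatrix R Q f).updateRow x b).det = 0 := by
  have hrow {v : V} (hv : ¬ ∃ n, f^[n] v ∈ Q) :
      (functionalMatrix R Q f).updateRow x b v = Pi.single v 1 - Pi.single (f v) 1 := by
    have hvQ : v ∉ Q := fun h => hv ⟨0, h⟩
    rw [updateRow_ne (ne_of_mem_of_not_mem hx hvQ).symm, functionalMatrix_of_notMem R f hvQ]
  refine det_eq_zero_of_singular_block (p := fun v => ∃ n, f^[n] v ∈ Q) (not_forall.1 hf)
    (fun v hv w hw => ?_) fun v hv => ?_
  · have hwf : w ≠ f v := by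
      rintro rfl
      obtain ⟨n, hn⟩ := hw
      exact hv ⟨n + 1, hn⟩
    rw [hrow hv, Pi.sub_apply, Pi.single_eq_of_ne (fun h : w = v => hv (h ▸ hw)),
      Pi.single_eq_of_ne hwf, sub_zero]
  · simp only [hrow hv, Pi.sub_apply, Finset.sum_sub_distrib, Finset.sum_pi_single',
      Finset.mem_univ, if_true, sub_self]

variable {R}

theorem laplacian_row (a : V → V → R) (v : V) :
    laplacian a v = ∑ t, a v t • ((Pi.single v 1 : V → R) - Pi.single t 1) := by
  ext w
  simp only [laplacian, Matrix.of_apply, Finset.sum_apply, Pi.smul_apply, Pi.sub_apply, smul_eq_mul,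
    mul_sub, Finset.sum_sub_distrib]
  by_cases h : v = w
  · subst h
    rw [← Finset.add_sum_erase Finset.univ _ (Finset.mem_univ v)]
    simp [Pi.single_apply]
  · simp [h, Pi.single_apply, Ne.symm h]

theorem det_pinRows_laplacian_updateRow (a : V → V → R) (hx : x ∈ Q) (b : V → R) :
    ((pinRows (laplacian a) Q).updateRow x b).det =
      ∑ f : V → V with ∀ q ∈ Q, f q = q,
        (∏ v ∈ Qᶜ, a v (f v)) * ((functionalMatrix R Q f).updateRow x b).det := by
  let targets (v : V) : Finset V := if v ∈ Q then {v} else Finset.univ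
  let weight (v t : V) : R := if v ∈ Q then 1 else a v t
  let row (v t : V) : V → R := (functionalMatrix R Q fun _ => t).updateRow x b v
  have hrows : (pinRows (laplacian a) Q).updateRow x b =
      fun v => ∑ t ∈ targets v, weight v t • row v t := by
    refine funext fun v => ?_
    by_cases hv : v ∈ Q
    · by_cases hvx : v = x
      · simp [targets, weight, row, hvx, hx]
      · simp [targets, weight, row, hv, hvx, updateRow_ne, pinRows_of_mem,
          functionalMatrix_of_mem]
    · have hvx : v ≠ x := (ne_of_mem_of_not_mem hx hv).symm
      simp [targets, weight, row, hv, hvx, updateRow_ne, pinRows_of_notMem,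
        functionalMatrix_of_notMem, laplacian_row]
  have htargets : Fintype.piFinset targets = ({f | ∀ q ∈ Q, f q = q} : Finset (V → V)) := by
    ext f
    simp only [Fintype.mem_piFinset, Finset.mem_filter_univ]
    refine forall_congr' fun v => ?_
    by_cases hv : v ∈ Q <;> simp [targets, hv]
  rw [← htargets, hrows]
  refine (detRowAlternating.toMultilinearMap.map_sum_finset
    (fun v t => weight v t • row v t) targets).trans (Finset.sum_congr rfl fun f _ => ?_)
  have hweight : ∏ v ∈ Qᶜ, a v (f v) = ∏ v, weight v (f v) := by
    rw [Finset.prod_ite]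
    simp [Finset.compl_eq_univ_sdiff, Finset.sdiff_eq_filter]
  have hrow : (fun v => row v (f v)) = (functionalMatrix R Q f).updateRow x b := by
    refine funext fun v => ?_
    by_cases hv : v ∈ Q <;> by_cases hvx : v = x <;>
      simp [row, hv, hvx, updateRow_ne, functionalMatrix_of_mem, functionalMatrix_of_notMem]
  rw [hweight, ← hrow]
  exact detRowAlternating.map_smul_univ _ _

/-- By the all-minors matrix tree theorem this counts forests rooted at `Q` in which `z` hangs from
the root `x`, see `rootedMinor_eq_sum_forests`. -/
def rootedMinor (a : V → V → R) (Q : Finset V) (x z : V) : R :=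
  ((pinRows (laplacian a) Q).updateRow x (Pi.single z 1)).det

open Classical in
theorem rootedMinor_eq_sum_maps (a : V → V → R) (hx : x ∈ Q) (z : V) :
    rootedMinor a Q x z = ∑ f : V → V with IsRootedMap Q f,
      if ∃ n, f^[n] z = x then ∏ v ∈ Qᶜ, a v (f v) else 0 := by
  rw [rootedMinor, det_pinRows_laplacian_updateRow a hx]
  symm
  refine Finset.sum_subset_zero_on_sdiff
    (Finset.monotone_filter_right _ fun f _ (hf : IsRootedMap Q f) => hf.map_root)
    (fun f hf => ?_) fun f hf => ?_
  · simp only [Finset.mem_sdiff, Finset.mem_filter_univ] at hf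
    rw [det_functionalMatrix_updateRow_eq_zero R (fun h => hf.2 ⟨hf.1, h⟩) hx, mul_zero]
  · rw [det_functionalMatrix_updateRow R ((Finset.mem_filter_univ f).1 hf) hx, mul_ite, mul_one,
      mul_zero]

end RootedMaps

/-! ### Rooted maps and rooted forests -/

section RootedForests

open SimpleGraph

variable {V : Type*}

/-- The graph whose edges are the elements of a finite set, loops being ignored. -/
abbrev edgeGraph (F : Finset (Sym2 V)) : SimpleGraph V := fromEdgeSet (F : Set (Sym2 V))

theorem edgeGraph_adj {F : Finset (Sym2 V)} {u w : V} :
    (edgeGraph F).Adj u w ↔ s(u, w) ∈ F ∧ u ≠ w := fromEdgeSet_adj _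

theorem edgeGraph_mono {F F' : Finset (Sym2 V)} (h : F ⊆ F') : edgeGraph F ≤ edgeGraph F' :=
  fromEdgeSet_mono (Finset.coe_subset.2 h)

/-- `F` is the edge set of a forest, each tree of which contains exactly one point of `Q`. -/
structure IsRootedForest (Q : Finset V) (F : Finset (Sym2 V)) : Prop where
  not_isDiag : ∀ e ∈ F, ¬ e.IsDiag
  isAcyclic : (edgeGraph F).IsAcyclic
  exists_root : ∀ v, ∃ q ∈ Q, (edgeGraph F).Reachable v q
  root_unique : ∀ q ∈ Q, ∀ q' ∈ Q, (edgeGraph F).Reachable q q' → q = q'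

theorem IsRootedForest.eq_of_subset {Q : Finset V} {F F' : Finset (Sym2 V)}
    (hF : IsRootedForest Q F) (hF' : IsRootedForest Q F') (hsub : F ⊆ F') : F = F' := by
  have hle := edgeGraph_mono hsub
  have hreach : (edgeGraph F).Reachable = (edgeGraph F').Reachable := by
    ext u w
    refine ⟨Reachable.mono hle, fun huw => ?_⟩
    obtain ⟨q, hq, huq⟩ := hF.exists_root u
    obtain ⟨q', hq', hwq'⟩ := hF.exists_root w
    obtain rfl := hF'.root_unique q hq q' hq'
      ((huq.mono hle).symm.trans (huw.trans (hwq'.mono hle)))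
    exact huq.trans hwq'.symm
  have hmax := (maximal_isAcyclic_iff_reachable_eq hle hF.isAcyclic).2 hreach
  refine hsub.antisymm fun e he => ?_
  induction e with
  | _ u w =>
    have hadj := edgeGraph_adj.2 ⟨he, fun h => hF'.not_isDiag _ he (Sym2.mk_isDiag_iff.2 h)⟩
    exact (edgeGraph_adj.1 (hmax.2 ⟨le_rfl, hF'.isAcyclic⟩ hle hadj)).1

/-- `f` moves each vertex along the first edge of a shortest walk to `Q`. -/
theorem exists_isRootedMap_adj {G : SimpleGraph V} {Q : Finset V}
    (hG : ∀ v, ∃ q ∈ Q, G.Reachable v q) : ∃ f, IsRootedMap Q f ∧ ∀ v ∉ Q, G.Adj v (f v) := by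
  classical
  have hwalk (v : V) : ∃ n, ∃ q ∈ Q, ∃ W : G.Walk v q, W.length = n :=
    let ⟨q, hq, ⟨W⟩⟩ := hG v
    ⟨W.length, q, hq, W, rfl⟩
  let d (v : V) : ℕ := Nat.find (hwalk v)
  have hstep : ∀ v ∉ Q, ∃ w, G.Adj v w ∧ d w < d v := by
    intro v hv
    obtain ⟨q, hq, W, hW⟩ := Nat.find_spec (hwalk v)
    cases W with
    | nil => exact absurd hq hv
    | cons hadj W =>
      exact ⟨_, hadj, (Nat.lt_succ_of_le (Nat.find_min' _ ⟨q, hq, W, rfl⟩)).trans_eq hW⟩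
  choose! next hadj hlt using hstep
  let f (v : V) : V := if v ∈ Q then v else next v
  have hf : ∀ v ∉ Q, f v = next v := fun v hv => if_neg hv
  refine ⟨f, ⟨fun q hq => if_pos hq, fun v => ?_⟩, fun v hv => (hf v hv).symm ▸ hadj v hv⟩
  induction hd : d v using Nat.strong_induction_on generalizing v with
  | _ _ ih =>
    by_cases hv : v ∈ Q
    · exact ⟨0, hv⟩
    · obtain ⟨n, hn⟩ := ih _ (hd ▸ hlt v hv) (next v) rfl
      exact ⟨n + 1, by rwa [Function.iterate_succ_apply, hf v hv]⟩

variable [DecidableEq V] [Fintype V] {Q : Finset V} {f : V → V}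

/-- The set of edges `s(v, f v)` with `v ∉ Q`, the forest encoded by a rooted map `f`. -/
def mapEdges (Q : Finset V) (f : V → V) : Finset (Sym2 V) := Qᶜ.image fun v => s(v, f v)

theorem mem_mapEdges {e : Sym2 V} : e ∈ mapEdges Q f ↔ ∃ v ∉ Q, s(v, f v) = e := by
  simp only [mapEdges, Finset.mem_image, Finset.mem_compl]

theorem mapEdges_adj {u w : V} :
    (edgeGraph (mapEdges Q f)).Adj u w ↔ (u ∉ Q ∧ f u = w ∨ w ∉ Q ∧ f w = u) ∧ u ≠ w := by
  rw [edgeGraph_adj, mem_mapEdges]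
  refine and_congr_left fun _ => ?_
  simp only [Sym2.eq_iff]
  constructor
  · rintro ⟨v, hv, ⟨rfl, rfl⟩ | ⟨rfl, rfl⟩⟩
    · exact Or.inl ⟨hv, rfl⟩
    · exact Or.inr ⟨hv, rfl⟩
  · rintro (⟨hu, rfl⟩ | ⟨hw, rfl⟩)
    · exact ⟨u, hu, Or.inl ⟨rfl, rfl⟩⟩
    · exact ⟨w, hw, Or.inr ⟨rfl, rfl⟩⟩

namespace IsRootedMap

theorem reachable_iterate (hf : IsRootedMap Q f) (v : V) (n : ℕ) :
    (edgeGraph (mapEdges Q f)).Reachable v (f^[n] v) := by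
  induction n with
  | zero => exact Reachable.refl _
  | succ n ih =>
    rw [Function.iterate_succ_apply']
    refine ih.trans ?_
    by_cases hn : f^[n] v ∈ Q
    · rw [hf.map_root _ hn]
    · exact (mapEdges_adj.2 ⟨Or.inl ⟨hn, rfl⟩, (hf.map_ne hn).symm⟩).reachable

theorem reachable_iff (hf : IsRootedMap Q f) {x : V} (hx : x ∈ Q) (z : V) :
    (edgeGraph (mapEdges Q f)).Reachable z x ↔ ∃ n, f^[n] z = x := by
  constructor
  · intro h
    induction (reachable_iff_reflTransGen x z).1 h.symm with
    | refl => exact ⟨0, rfl⟩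
    | @tail u w hxu huw ih =>
      specialize ih ((reachable_iff_reflTransGen x u).2 hxu).symm
      obtain ⟨⟨_, rfl⟩ | ⟨_, rfl⟩, _⟩ := mapEdges_adj.1 huw
      · exact (hf.exists_iterate_map_eq_iff hx u).2 ih
      · exact (hf.exists_iterate_map_eq_iff hx w).1 ih
  · rintro ⟨n, rfl⟩
    exact hf.reachable_iterate z n

/-- Without the edge `s(v, f v)`, only vertices whose orbit passes through `v` are connected to
`v`; the orbit of `f v` does not. -/
theorem isAcyclic_mapEdges (hf : IsRootedMap Q f) : (edgeGraph (mapEdges Q f)).IsAcyclic := by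
  rw [isAcyclic_iff_forall_isBridge]
  intro e he
  rw [edgeSet_fromEdgeSet] at he
  obtain ⟨v, hv, rfl⟩ := mem_mapEdges.1 he.1
  rw [isBridge_iff, reachable_iff_reflTransGen]
  have horbit {x : V} (h : Relation.ReflTransGen
      ((edgeGraph (mapEdges Q f)).deleteEdges {s(v, f v)}).Adj v x) : ∃ n, f^[n] x = v := by
    induction h with
    | refl => exact ⟨0, rfl⟩
    | @tail u w _ huw ih =>
      rw [deleteEdges_adj, mapEdges_adj] at huw
      obtain ⟨⟨⟨_, rfl⟩ | ⟨_, rfl⟩, _⟩, hne⟩ := huw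
      · obtain ⟨_ | n, hn⟩ := ih
        · obtain rfl : u = v := hn
          exact absurd rfl hne
        · exact ⟨n, hn⟩
      · obtain ⟨n, hn⟩ := ih
        exact ⟨n + 1, hn⟩
  intro h
  obtain ⟨n, hn⟩ := horbit h
  exact hf.iterate_map_ne hv n hn

theorem isRootedForest (hf : IsRootedMap Q f) : IsRootedForest Q (mapEdges Q f) where
  not_isDiag e he := by
    obtain ⟨v, hv, rfl⟩ := mem_mapEdges.1 he
    exact fun h => hf.map_ne hv (Sym2.mk_isDiag_iff.1 h).symm
  isAcyclic := hf.isAcyclic_mapEdges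
  exists_root v :=
    let ⟨n, hn⟩ := hf.exists_iterate_mem v
    ⟨_, hn, hf.reachable_iterate v n⟩
  root_unique q hq q' hq' h :=
    (hf.exists_iterate_eq_iff_eq hq q').1 ((hf.reachable_iff hq' q).1 h)

theorem injOn_edge (hf : IsRootedMap Q f) : Set.InjOn (fun v => s(v, f v)) (Qᶜ : Finset V) := by
  intro v hv w _ h
  rcases Sym2.eq_iff.1 h with ⟨hvw, _⟩ | ⟨hvw, hfv⟩
  · exact hvw
  · exact absurd ((congrArg f hfv).trans hvw.symm)
      (hf.iterate_map_ne (Finset.mem_compl.1 hv) 1)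

theorem eq_of_mapEdges_eq {g : V → V} (hf : IsRootedMap Q f) (hg : IsRootedMap Q g)
    (h : mapEdges Q f = mapEdges Q g) : f = g := by
  by_contra hne
  obtain ⟨v, hv⟩ := Function.ne_iff.1 hne
  have hQ {v : V} (hv : f v ≠ g v) : v ∉ Q := fun hvQ =>
    hv ((hf.map_root v hvQ).trans (hg.map_root v hvQ).symm)
  -- disagreement propagates along the orbit of `f`, hence up to `Q`
  have hstep {v : V} (hv : f v ≠ g v) : f (f v) ≠ g (f v) := by
    have hmem : s(v, f v) ∈ mapEdges Q g := h ▸ mem_mapEdges.2 ⟨v, hQ hv, rfl⟩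
    obtain ⟨u, _, hu⟩ := mem_mapEdges.1 hmem
    rcases Sym2.eq_iff.1 hu with ⟨rfl, hgu⟩ | ⟨rfl, hgu⟩
    · exact absurd hgu.symm hv
    · rw [hgu]
      exact hf.iterate_map_ne (hQ hv) 1
  have horbit (n : ℕ) : f (f^[n] v) ≠ g (f^[n] v) := by
    induction n with
    | zero => exact hv
    | succ n ih =>
      rw [Function.iterate_succ_apply']
      exact hstep ih
  obtain ⟨n, hn⟩ := hf.exists_iterate_mem v
  exact hQ (horbit n) hn

end IsRootedMap

theorem IsRootedForest.exists_mapEdges_eq {F : Finset (Sym2 V)} (hF : IsRootedForest Q F) :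
    ∃ f, IsRootedMap Q f ∧ mapEdges Q f = F := by
  obtain ⟨f, hf, hadj⟩ := exists_isRootedMap_adj hF.exists_root
  refine ⟨f, hf, hf.isRootedForest.eq_of_subset hF fun e he => ?_⟩
  obtain ⟨v, hv, rfl⟩ := mem_mapEdges.1 he
  exact (edgeGraph_adj.1 (hadj v hv)).1

open Classical in
theorem rootedMinor_eq_sum_forests {R : Type*} [CommRing R] (a : Sym2 V → R) {x : V} (hx : x ∈ Q)
    (z : V) :
    rootedMinor (fun u v => a s(u, v)) Q x z =
      ∑ F : Finset (Sym2 V) with IsRootedForest Q F,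
        if (edgeGraph F).Reachable z x then ∏ e ∈ F, a e else 0 := by
  rw [rootedMinor_eq_sum_maps _ hx]
  have hmem {f : V → V} (hf : f ∈ ({f | IsRootedMap Q f} : Finset (V → V))) : IsRootedMap Q f :=
    (Finset.mem_filter_univ f).1 hf
  refine Finset.sum_bij (fun f _ => mapEdges Q f)
    (fun f hf => (Finset.mem_filter_univ _).2 (hmem hf).isRootedForest)
    (fun f hf g hg h => (hmem hf).eq_of_mapEdges_eq (hmem hg) h) (fun F hF => ?_) fun f hf => ?_
  · obtain ⟨f, hf, hfF⟩ := ((Finset.mem_filter_univ F).1 hF).exists_mapEdges_eq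
    exact ⟨f, (Finset.mem_filter_univ f).2 hf, hfF⟩
  · replace hf := hmem hf
    rw [mapEdges, Finset.prod_image hf.injOn_edge, ← mapEdges]
    exact if_congr (hf.reachable_iff hx z).symm rfl rfl

end RootedForests

/-! ### Transversals of set partitions -/

section Transversals

variable {α : Type*} [Fintype α] [DecidableEq α] {P : Finpartition (Finset.univ : Finset α)}
  {Q : Finset α}

theorem part_mem_parts (P : Finpartition (Finset.univ : Finset α)) (u : α) : P.part u ∈ P.parts :=
  P.part_mem.2 (Finset.mem_univ u)

theorem mem_part_iff {u v : α} : u ∈ P.part v ↔ P.part u = P.part v :=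
  P.mem_part_iff_part_eq_part (Finset.mem_univ u) (Finset.mem_univ v)

theorem eq_of_part_eq_part_iff {P' : Finpartition (Finset.univ : Finset α)}
    (h : ∀ u v, P.part u = P.part v ↔ P'.part u = P'.part v) : P = P' := by
  have hpart (u : α) : P.part u = P'.part u := by
    ext v
    rw [mem_part_iff, mem_part_iff, h]
  ext p
  constructor <;> intro hp
  · obtain ⟨u, -, rfl⟩ := P.part_surjOn hp
    exact hpart u ▸ part_mem_parts P' u
  · obtain ⟨u, -, rfl⟩ := P'.part_surjOn hp
    exact (hpart u).symm ▸ part_mem_parts P u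

/-- Every part of `P` contains exactly one point of `Q`. -/
def IsTransversal (P : Finpartition (Finset.univ : Finset α)) (Q : Finset α) : Prop :=
  Set.BijOn P.part Q P.parts

theorem isTransversal_iff_injOn :
    IsTransversal P Q ↔ P.parts.card = Q.card ∧ Set.InjOn P.part Q := by
  have hmaps : Set.MapsTo P.part Q P.parts := fun u _ => part_mem_parts P u
  exact ⟨fun h => ⟨h.finsetCard_eq.symm, h.injOn⟩, fun h =>
    ⟨hmaps, h.2, Finset.surjOn_of_injOn_of_card_le _ hmaps h.2 h.1.le⟩⟩

theorem isTransversal_iff_surjOn :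
    IsTransversal P Q ↔ P.parts.card = Q.card ∧ Set.SurjOn P.part Q P.parts := by
  have hmaps : Set.MapsTo P.part Q P.parts := fun u _ => part_mem_parts P u
  exact ⟨fun h => ⟨h.finsetCard_eq.symm, h.surjOn⟩, fun h =>
    ⟨hmaps, Finset.injOn_of_surjOn_of_card_le _ hmaps h.2 h.1.ge, h.2⟩⟩

theorem isTransversal_pair {u v : α} (huv : u ≠ v) :
    IsTransversal P {u, v} ↔ P.parts.card = 2 ∧ P.part u ≠ P.part v := by
  rw [isTransversal_iff_injOn, Finset.card_pair huv, Finset.coe_pair, Set.injOn_pair]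
  exact and_congr_right fun _ => ⟨fun h huv' => huv (h huv'), fun h huv' => absurd huv' h⟩

theorem isTransversal_erase {u v : α} (huv : u ≠ v) (h : P.part u = P.part v) :
    IsTransversal P (Finset.univ.erase u) ↔ P.parts.card + 1 = Fintype.card α := by
  have hsurj : Set.SurjOn P.part (Finset.univ.erase u : Finset α) P.parts := by
    intro p hp
    obtain ⟨w, -, rfl⟩ := P.part_surjOn hp
    by_cases hw : w = u
    · exact ⟨v, Finset.mem_coe.2 (Finset.mem_erase.2 ⟨huv.symm, Finset.mem_univ v⟩), hw ▸ h.symm⟩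
    · exact ⟨w, Finset.mem_coe.2 (Finset.mem_erase.2 ⟨hw, Finset.mem_univ w⟩), rfl⟩
  have hcard := Finset.card_erase_add_one (Finset.mem_univ u)
  rw [isTransversal_iff_surjOn, and_iff_left hsurj, ← Finset.card_univ, ← hcard,
    Nat.add_right_cancel_iff]

theorem IsTransversal.exists_part_eq {u : α} (h : IsTransversal P (Finset.univ.erase u)) :
    ∃ v ≠ u, P.part v = P.part u := by
  obtain ⟨v, hv, hvu⟩ := h.surjOn (part_mem_parts P u)
  exact ⟨v, Finset.ne_of_mem_erase hv, hvu⟩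

theorem IsTransversal.eq_of_part_eq {u v w : α} (h : IsTransversal P (Finset.univ.erase u))
    (hv : v ≠ u) (hw : w ≠ u) (hvw : P.part v = P.part w) : v = w :=
  h.injOn (Finset.mem_erase.2 ⟨hv, Finset.mem_univ v⟩) (Finset.mem_erase.2 ⟨hw, Finset.mem_univ w⟩)
    hvw

theorem IsTransversal.part_eq_pair {u v : α} (h : IsTransversal P (Finset.univ.erase u))
    (hvu : v ≠ u) (huv : P.part v = P.part u) : P.part u = {u, v} := by
  ext w
  rw [mem_part_iff, Finset.mem_insert, Finset.mem_singleton, or_iff_not_imp_left]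
  refine ⟨fun hw hwu => h.eq_of_part_eq hwu hvu (hw.trans huv.symm), fun hw => ?_⟩
  by_cases hwu : w = u
  · rw [hwu]
  · rw [hw hwu, huv]

theorem IsTransversal.part_eq_singleton {u v w : α} (h : IsTransversal P (Finset.univ.erase u))
    (hvu : v ≠ u) (huv : P.part v = P.part u) (hwu : w ≠ u) (hwv : w ≠ v) : P.part w = {w} := by
  ext x
  rw [mem_part_iff, Finset.mem_singleton]
  refine ⟨fun hx => ?_, congrArg P.part⟩
  refine h.eq_of_part_eq (fun hxu => hwv ?_) hwu hx
  exact h.eq_of_part_eq hwu hvu (by rw [← hx, hxu, huv])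

theorem isTransversal_singleton {u : α} : IsTransversal P {u} ↔ ∀ v, P.part v = P.part u := by
  constructor
  · intro h v
    obtain ⟨w, hw, hwv⟩ := h.surjOn (part_mem_parts P v)
    rw [← hwv, Finset.mem_singleton.1 hw]
  · intro h
    refine ⟨fun v _ => part_mem_parts P v, by simp, fun p hp => ?_⟩
    obtain ⟨v, -, rfl⟩ := P.part_surjOn hp
    exact ⟨u, Finset.mem_coe.2 (Finset.mem_singleton_self u), (h v).symm⟩

theorem isTransversal_univ : IsTransversal P Finset.univ ↔ Function.Injective P.part := by
  rw [IsTransversal, Finset.coe_univ, ← Set.injOn_univ]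
  exact ⟨Set.BijOn.injOn, fun h => ⟨fun v _ => part_mem_parts P v, h, by simpa using P.part_surjOn⟩⟩

theorem part_eq_part_iff_of_card_eq_two (hP : P.parts.card = 2) (u v w : α) :
    P.part u = P.part v ↔ (P.part u = P.part w ↔ P.part v = P.part w) := by
  refine ⟨fun huv => by rw [huv], fun h => ?_⟩
  by_contra huv
  have huw : P.part u ≠ P.part w := fun huw => huv (huw.trans (h.1 huw).symm)
  have hvw : P.part v ≠ P.part w := fun hvw => huw (h.2 hvw)
  exact hP.not_gt (Finset.two_lt_card.2 ⟨P.part u, part_mem_parts P u, P.part v,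
    part_mem_parts P v, P.part w, part_mem_parts P w, huv, huw, hvw⟩)

end Transversals

/-! ### Forests compatible with a set partition of the marked vertices -/

section Expansions

open SimpleGraph MvPolynomial

variable {m n : ℕ} {h : m ≤ n} {P P' : MarkedPartition m} {F : Finset (Sym2 (Fin n))}
  {Q : Finset (Fin m)}

theorem isCompatibleForest_iff :
    IsCompatibleForest h P F ↔ (edgeGraph F).IsAcyclic ∧
      (∀ v, ∃ u, (edgeGraph F).Reachable v (Fin.castLE h u)) ∧
      ∀ u w, (edgeGraph F).Reachable (Fin.castLE h u) (Fin.castLE h w) ↔ P.part u = P.part w := by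
  refine and_congr_right fun _ => ⟨?_, ?_⟩
  · rintro ⟨φ, hφ⟩
    have hmk (u : Fin m) : (edgeGraph F).connectedComponentMk (Fin.castLE h u) =
        φ ⟨P.part u, part_mem_parts P u⟩ := hφ _ u (mem_part_iff.2 rfl)
    refine ⟨fun v => ?_, fun u w => ?_⟩
    · obtain ⟨u, hu⟩ := P.nonempty_of_mem_parts (φ.symm (connectedComponentMk _ v)).2
      exact ⟨u, ConnectedComponent.eq.1 (by rw [hφ _ u hu, φ.apply_symm_apply])⟩
    · rw [← ConnectedComponent.eq, hmk, hmk, φ.injective.eq_iff, Subtype.mk.injEq]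
  · rintro ⟨hmarked, hreach⟩
    choose rep hrep using fun p : {p // p ∈ P.parts} => P.nonempty_of_mem_parts p.2
    have hpart (p : {p // p ∈ P.parts}) : P.part (rep p) = p := P.part_eq_of_mem p.2 (hrep p)
    let comp (p : {p // p ∈ P.parts}) := (edgeGraph F).connectedComponentMk (Fin.castLE h (rep p))
    have hcomp {u : Fin m} {p : {p // p ∈ P.parts}} (hu : P.part u = p) :
        (edgeGraph F).connectedComponentMk (Fin.castLE h u) = comp p :=
      ConnectedComponent.eq.2 ((hreach _ _).2 (hu.trans (hpart p).symm))
    refine ⟨Equiv.ofBijective comp ⟨fun p p' hpp' => Subtype.ext ?_, fun C => ?_⟩,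
      fun p v hv => hcomp (P.part_eq_of_mem p.2 hv)⟩
    · rw [← hpart p, ← hpart p']
      exact (hreach _ _).1 (ConnectedComponent.eq.1 hpp')
    · induction C using ConnectedComponent.ind with
      | _ v =>
        obtain ⟨u, hu⟩ := hmarked v
        exact ⟨⟨P.part u, part_mem_parts P u⟩,
          (hcomp rfl).symm.trans (ConnectedComponent.eq.2 hu.symm)⟩

theorem mem_compatibleForests_top :
    F ∈ compatibleForests h ⊤ P ↔ (∀ e ∈ F, ¬ e.IsDiag) ∧ IsCompatibleForest h P F := by
  simp [compatibleForests, Finset.subset_iff, edgeSet_top]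

theorem IsCompatibleForest.unique (hP : IsCompatibleForest h P F)
    (hP' : IsCompatibleForest h P' F) : P = P' :=
  eq_of_part_eq_part_iff fun u v =>
    ((isCompatibleForest_iff.1 hP).2.2 u v).symm.trans ((isCompatibleForest_iff.1 hP').2.2 u v)

theorem exists_mem_compatibleForests [NeZero m] (h : m ≤ n) (P : MarkedPartition m) :
    ∃ F, F ∈ compatibleForests h ⊤ P := by
  classical
  let mark : Fin n → Fin m := Function.invFun (Fin.castLE h)
  have hmark (u : Fin m) : mark (Fin.castLE h u) = u :=
    Function.leftInverse_invFun (Fin.castLE_injective h) u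
  let G : SimpleGraph (Fin n) := fromRel fun v w => P.part (mark v) = P.part (mark w)
  have hG (v w : Fin n) : G.Reachable v w ↔ P.part (mark v) = P.part (mark w) := by
    refine ⟨fun hvw => ?_, fun hvw => ?_⟩
    · induction (reachable_iff_reflTransGen v w).1 hvw with
      | refl => rfl
      | tail hvu huw ih =>
        exact (ih ((reachable_iff_reflTransGen _ _).2 hvu)).trans (huw.2.elim id Eq.symm)
    · by_cases hne : v = w
      · exact hne ▸ Reachable.refl v
      · exact Adj.reachable ⟨hne, Or.inl hvw⟩
  obtain ⟨T, -, hT, hTG⟩ := G.exists_isAcyclic_reachable_eq_le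
  have hedge : edgeGraph T.edgeFinset = T := by
    rw [edgeGraph, coe_edgeFinset, fromEdgeSet_edgeSet]
  refine ⟨T.edgeFinset, mem_compatibleForests_top.2 ⟨fun e he =>
    T.not_isDiag_of_mem_edgeFinset he, isCompatibleForest_iff.2 ?_⟩⟩
  rw [hedge, hTG]
  refine ⟨hT, fun v => ⟨mark v, (hG _ _).2 ?_⟩, fun u w => ?_⟩
  · rw [hmark]
  · rw [hG, hmark, hmark]

theorem isRootedForest_map_iff : IsRootedForest (Q.map (Fin.castLEEmb h)) F ↔
    ∃ P, F ∈ compatibleForests h ⊤ P ∧ IsTransversal P Q := by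
  classical
  simp only [mem_compatibleForests_top]
  constructor
  · intro hF
    let P : MarkedPartition m :=
      Finpartition.ofSetoid ((edgeGraph F).reachableSetoid.comap (Fin.castLE h))
    have hpart (u w : Fin m) : (edgeGraph F).Reachable (Fin.castLE h u) (Fin.castLE h w) ↔
        P.part u = P.part w := by
      rw [eq_comm, ← mem_part_iff, Finpartition.mem_part_ofSetoid_iff_rel]
      rfl
    have hroot (v : Fin n) : ∃ q ∈ Q, (edgeGraph F).Reachable v (Fin.castLE h q) := by
      obtain ⟨_, hmem, hreach⟩ := hF.exists_root v
      obtain ⟨q, hq, rfl⟩ := Finset.mem_map.1 hmem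
      exact ⟨q, hq, hreach⟩
    refine ⟨P, ⟨hF.not_isDiag, isCompatibleForest_iff.2 ⟨hF.isAcyclic, fun v => ?_, hpart⟩⟩,
      fun u _ => part_mem_parts P u, fun q hq q' hq' hqq' => ?_, fun p hp => ?_⟩
    · exact (hroot v).imp fun _ => And.right
    · exact (Fin.castLEEmb h).injective (hF.root_unique _ (Finset.mem_map_of_mem _ hq) _
        (Finset.mem_map_of_mem _ hq') ((hpart q q').2 hqq'))
    · obtain ⟨u, -, rfl⟩ := P.part_surjOn hp
      obtain ⟨q, hq, huq⟩ := hroot (Fin.castLE h u)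
      exact ⟨q, hq, ((hpart u q).1 huq).symm⟩
  · rintro ⟨P, ⟨hdiag, hF⟩, hQ⟩
    obtain ⟨hacyclic, hmarked, hreach⟩ := isCompatibleForest_iff.1 hF
    refine ⟨hdiag, hacyclic, fun v => ?_, Finset.forall_mem_map.2 fun q hq =>
      Finset.forall_mem_map.2 fun q' hq' hqq' => congrArg _ (hQ.injOn hq hq' ?_)⟩
    · obtain ⟨u, hu⟩ := hmarked v
      obtain ⟨q, hq, hqu⟩ := hQ.surjOn (part_mem_parts P u)
      exact ⟨_, Finset.mem_map_of_mem _ hq, hu.trans ((hreach u q).2 hqu.symm)⟩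
    · exact (hreach q q').1 hqq'

open Classical in
/-- The coefficients of the forest expansion of `rootedMinor`, see
`isForestExpansion_rootedMinor`. -/
def rootedCoeff (Q : Finset (Fin m)) (x z : Fin m) (P : MarkedPartition m) : ℤ :=
  if IsTransversal P Q ∧ P.part z = P.part x then 1 else 0

theorem isForestExpansion_rootedMinor (h : m ≤ n) {x : Fin m} (hx : x ∈ Q) (z : Fin m) :
    IsForestExpansion h (rootedCoeff Q x z)
      (rootedMinor (fun u v => X s(u, v)) (Q.map (Fin.castLEEmb h))
        (Fin.castLE h x) (Fin.castLE h z)) := by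
  classical
  have hforests : ({F | IsRootedForest (Q.map (Fin.castLEEmb h)) F} : Finset _) =
      ({P | IsTransversal P Q} : Finset (MarkedPartition m)).biUnion (compatibleForests h ⊤) := by
    ext F
    simp only [Finset.mem_filter_univ, Finset.mem_biUnion, isRootedForest_map_iff, and_comm]
  have hroot : Fin.castLE h x ∈ Q.map (Fin.castLEEmb h) := Finset.mem_map_of_mem _ hx
  rw [IsForestExpansion, rootedMinor_eq_sum_forests X hroot, hforests, Finset.sum_biUnion,
    Finset.sum_filter]
  · refine Finset.sum_congr rfl fun P _ => ?_
    rw [forestSum, Finset.mul_sum]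
    by_cases hP : IsTransversal P Q
    · rw [if_pos hP]
      refine Finset.sum_congr rfl fun F hF => ?_
      have hreach := (isCompatibleForest_iff.1 (mem_compatibleForests_top.1 hF).2).2.2 z x
      simp only [rootedCoeff, hP, true_and, hreach]
      split_ifs <;> simp
    · simp [rootedCoeff, hP]
  · refine fun P _ P' _ hne => Finset.disjoint_left.2 fun F hF hF' => hne ?_
    exact (mem_compatibleForests_top.1 hF).2.unique (mem_compatibleForests_top.1 hF').2

theorem coeff_forestSum [DecidableEq (Finset (Sym2 (Fin n)))] (P : MarkedPartition m) :
    coeff (∑ e ∈ F, Finsupp.single e 1) (forestSum h P) =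
      if F ∈ compatibleForests h ⊤ P then 1 else 0 := by
  have hmonomial (F' : Finset (Sym2 (Fin n))) :
      coeff (∑ e ∈ F, Finsupp.single e 1) (∏ e ∈ F', (X e : MvPolynomial _ ℤ)) =
        if F' = F then 1 else 0 := by
    classical
    have hsupport (F : Finset (Sym2 (Fin n))) :
        (∑ e ∈ F, Finsupp.single e (1 : ℕ)).support = F := by
      ext e
      simp [Finsupp.finsetSum_apply, Finsupp.single_apply]
    rw [show ∏ e ∈ F', X e = monomial (∑ e ∈ F', Finsupp.single e 1) (1 : ℤ) from
      (monomial_sum_one F' _).symm, coeff_monomial]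
    exact if_congr ⟨fun hF => by rw [← hsupport F', hF, hsupport], fun hF => hF ▸ rfl⟩ rfl rfl
  simp only [forestSum, coeff_sum, hmonomial, Finset.sum_ite_eq']

namespace IsForestExpansion

variable {α β : MarkedPartition m → ℤ} {p q : MvPolynomial (Sym2 (Fin n)) ℤ}

theorem unique [NeZero m] (hα : IsForestExpansion h α p) (hβ : IsForestExpansion h β p) :
    α = β := by
  classical
  funext P
  obtain ⟨F, hF⟩ := exists_mem_compatibleForests h P
  have hcoeff {γ : MarkedPartition m → ℤ} (hγ : IsForestExpansion h γ p) :
      coeff (∑ e ∈ F, Finsupp.single e 1) p = γ P := by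
    have hmem (P' : MarkedPartition m) : F ∈ compatibleForests h ⊤ P' ↔ P' = P :=
      ⟨fun hF' => (mem_compatibleForests_top.1 hF').2.unique (mem_compatibleForests_top.1 hF).2,
        fun hP' => hP' ▸ hF⟩
    rw [hγ, coeff_sum]
    simp only [coeff_C_mul, coeff_forestSum, hmem, mul_ite, mul_one, mul_zero, Finset.sum_ite_eq',
      Finset.mem_univ, if_true]
  exact (hcoeff hα).symm.trans (hcoeff hβ)

theorem smul (hα : IsForestExpansion h α p) (a : ℤ) : IsForestExpansion h (a • α) (C a * p) := by
  rw [IsForestExpansion, hα, Finset.mul_sum]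
  refine Finset.sum_congr rfl fun P _ => ?_
  rw [Pi.smul_apply, smul_eq_mul, C_mul, mul_assoc]

theorem sub (hα : IsForestExpansion h α p) (hβ : IsForestExpansion h β q) :
    IsForestExpansion h (α - β) (p - q) := by
  rw [IsForestExpansion, hα, hβ, ← Finset.sum_sub_distrib]
  refine Finset.sum_congr rfl fun P _ => ?_
  rw [Pi.sub_apply, C_sub, sub_mul]

end IsForestExpansion

end Expansions

/-! ### Minors of the Laplacian with marked vertices -/

section LaplacianMinors

open Matrix MvPolynomial

theorem sum_laplacian_row {V R : Type*} [Fintype V] [DecidableEq V] [CommRing R] (a : V → V → R)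
    (v : V) : ∑ w, laplacian a v w = 0 := by
  have hdot : laplacian a v ⬝ᵥ 1 = 0 := by
    rw [laplacian_row, sum_dotProduct]
    refine Finset.sum_eq_zero fun t _ => ?_
    rw [smul_dotProduct, sub_dotProduct, single_one_dotProduct, single_one_dotProduct,
      Pi.one_apply, Pi.one_apply, sub_self, smul_zero]
  rwa [dotProduct_one] at hdot

theorem det_updateRow_updateRow_laplacian {V R : Type*} [Fintype V] [DecidableEq V] [CommRing R]
    (a : V → V → R) {x y : V} (hxy : x ≠ y) (z w : V) :
    (((laplacian a).updateRow y (Pi.single w 1)).updateRow x (Pi.single z 1)).det =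
      rootedMinor a {x, y} x z - rootedMinor a {x, y} x w := by
  have hminor (t : V) : rootedMinor a {x, y} x t =
      (((laplacian a).updateRow y (Pi.single y 1)).updateRow x (Pi.single t 1)).det := by
    rw [rootedMinor, pinRows_insert, pinRows_singleton, updateRow_idem]
  -- all rows of this matrix sum to zero, as those of the Laplacian do
  have hzero : (((laplacian a).updateRow y (Pi.single w 1 - Pi.single y 1)).updateRow x
      (Pi.single z 1 - Pi.single w 1)).det = 0 := by
    have : Nonempty V := ⟨x⟩
    refine det_eq_zero_of_forall_sum_eq_zero fun v => ?_
    have hsingle (s t : V) : ∑ u, (Pi.single s 1 - Pi.single t 1 : V → R) u = 0 := by simp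
    obtain rfl | hvx := eq_or_ne v x
    · rw [updateRow_self, hsingle]
    obtain rfl | hvy := eq_or_ne v y
    · rw [updateRow_ne hvx, updateRow_self, hsingle]
    · rw [updateRow_ne hvx, updateRow_ne hvy, sum_laplacian_row]
  have hrepeat :
      (((laplacian a).updateRow x (Pi.single w 1)).updateRow y (Pi.single w 1)).det = 0 :=
    det_zero_of_row_eq hxy (by rw [updateRow_ne hxy, updateRow_self, updateRow_self])
  rw [hminor, hminor]
  rw [det_updateRow_sub] at hzero
  simp only [updateRow_comm _ hxy.symm] at hzero ⊢
  rw [det_updateRow_sub, det_updateRow_sub, hrepeat] at hzero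
  linear_combination hzero

theorem submatrix_updateRow_single {l m R : Type*} [DecidableEq l] [DecidableEq m] [Zero R] [One R]
    (A : Matrix m m R) {f g : l → m} (hf : Function.Injective f) (hg : Function.Injective g)
    (i j : l) :
    (A.submatrix f g).updateRow i (Pi.single j 1) =
      (A.updateRow (f i) (Pi.single (g j) 1)).submatrix f g := by
  ext v w
  simp only [submatrix_apply, updateRow_apply, hf.eq_iff, Pi.single_apply, hg.eq_iff]

variable {k N : ℕ} (h : k ≤ N)

/-- The inclusion of the marked vertices into all vertices. -/
abbrev markedVertex : Fin (k + 1) ↪ Fin (N + 1) := Fin.castLEEmb (Nat.succ_le_succ h)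

theorem reducedLaplacian_eq (r c : Fin (k + 1)) :
    reducedLaplacian h r c = (completeLaplacian (N + 1)).submatrix
      (markedVertex h r).succAbove (markedVertex h c).succAbove := rfl

theorem markedVertex_succAbove (r : Fin (k + 1)) (i : Fin k) :
    (markedVertex h r).succAbove (Fin.castLE h i) = markedVertex h (r.succAbove i) := by
  ext
  simp only [Fin.succAbove, Fin.lt_def, Fin.val_castSucc, Fin.castLEEmb_apply, Fin.val_castLE]
  split_ifs <;> rfl

theorem succAbove_markedVertex_of_le (r : Fin (k + 1)) {v : Fin N} (hv : k ≤ v.val) :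
    (markedVertex h r).succAbove v = v.succ :=
  Fin.succAbove_of_le_castSucc _ _ (Fin.le_def.2 ((Nat.le_of_lt_succ r.isLt).trans hv))

theorem notMem_map_markedVertex {v : Fin (N + 1)} :
    v ∉ Finset.univ.map (markedVertex h) ↔ k + 1 ≤ v.val := by
  rw [Finset.mem_map, ← not_lt, not_iff_not]
  exact ⟨fun ⟨u, _, hu⟩ => hu ▸ u.isLt, fun hv => ⟨⟨v, hv⟩, Finset.mem_univ _, rfl⟩⟩

theorem image_succAbove_markedVertex (r : Fin (k + 1)) :
    (markedVertex h r).succAbove '' {v | k ≤ v.val} =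
      {v | v ∉ Finset.univ.map (markedVertex h)} := by
  ext v
  simp only [Set.mem_image, Set.mem_ofPred_eq, notMem_map_markedVertex]
  constructor
  · rintro ⟨u, hu, rfl⟩
    rw [succAbove_markedVertex_of_le h r hu]
    exact Nat.succ_le_succ hu
  · intro hv
    obtain ⟨u, rfl⟩ := Fin.exists_succ_eq.2 (Fin.pos_iff_ne_zero.1 (k.succ_pos.trans_le hv))
    have hu : k ≤ u.val := Nat.le_of_succ_le_succ hv
    exact ⟨u, hu, succAbove_markedVertex_of_le h r hu⟩

theorem range_orderEmbOfFin_compl_initialSeg :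
    Set.range ((initialSeg k N)ᶜ.orderEmbOfFin rfl) = {v | k ≤ v.val} := by
  ext v
  rw [← notMem_iff_mem_range_orderEmbOfFin_compl, mem_initialSeg, not_lt, Set.mem_ofPred_eq]

theorem range_orderEmbOfFin_compl_initialSeg_sdiff (j : Fin k) :
    Set.range ((initialSeg k N \ {Fin.castLE h j})ᶜ.orderEmbOfFin rfl) =
      insert (Fin.castLE h j) {v | k ≤ v.val} := by
  ext v
  rw [Finset.range_orderEmbOfFin, Finset.mem_coe, mem_compl_initialSeg_sdiff, Set.mem_insert_iff,
    Set.mem_ofPred_eq]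

/-- The rooted minors of the Laplacian of the complete graph, indexed by marked vertices. -/
def markedMinor (Q : Finset (Fin (k + 1))) (x z : Fin (k + 1)) :
    MvPolynomial (Sym2 (Fin (N + 1))) ℤ :=
  rootedMinor (fun u v => X s(u, v)) (Q.map (markedVertex h)) (markedVertex h x) (markedVertex h z)

theorem isForestExpansion_markedMinor {Q : Finset (Fin (k + 1))} {x : Fin (k + 1)} (hx : x ∈ Q)
    (z : Fin (k + 1)) :
    IsForestExpansion (Nat.succ_le_succ h) (rootedCoeff Q x z) (markedMinor h Q x z) :=
  isForestExpansion_rootedMinor _ hx z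

theorem markedMinor_self {Q : Finset (Fin (k + 1))} {x : Fin (k + 1)} (hx : x ∈ Q) :
    markedMinor h Q x x = (pinRows (completeLaplacian (N + 1)) (Q.map (markedVertex h))).det := by
  rw [markedMinor, rootedMinor, pinRows_updateRow_single_self _ (Finset.mem_map_of_mem _ hx)]
  rfl

theorem det_reducedLaplacian (r c : Fin (k + 1)) :
    (reducedLaplacian h r c).det = C ((-1) ^ (r.val + c.val)) * markedMinor h {r} r c := by
  rw [reducedLaplacian, det_submatrix_succAbove, markedMinor, rootedMinor, Finset.map_singleton,
    pinRows_singleton, updateRow_idem]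
  simp [completeLaplacian]

theorem firstFactor_reducedLaplacian (r c : Fin (k + 1)) (i j : Fin k) :
    firstFactor (reducedLaplacian h r c) h i j =
      C ((-1) ^ (i.val + j.val + (r.val + c.val))) *
        (markedMinor h {r, r.succAbove i} r c -
          markedMinor h {r, r.succAbove i} r (c.succAbove j)) := by
  have hne : markedVertex h r ≠ markedVertex h (r.succAbove i) :=
    (markedVertex h).injective.ne (Fin.succAbove_ne r i).symm
  rw [firstFactor, minor_singleton, reducedLaplacian_eq,
    submatrix_updateRow_single _ Fin.succAbove_right_injective Fin.succAbove_right_injective,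
    markedVertex_succAbove, markedVertex_succAbove, det_submatrix_succAbove, completeLaplacian,
    det_updateRow_updateRow_laplacian _ hne]
  simp only [markedMinor, Finset.map_insert, Finset.map_singleton, Fin.val_castLE, pow_add,
    C_mul, map_pow, map_neg, map_one, Fin.castLEEmb_apply]
  ring

theorem minor_initialSeg_reducedLaplacian (r c : Fin (k + 1)) :
    minor (reducedLaplacian h r c) (initialSeg k N) (initialSeg k N) =
      markedMinor h Finset.univ 0 0 := by
  set e := (initialSeg k N)ᶜ.orderEmbOfFin rfl with he
  have hrange : Set.range e = {v | k ≤ v.val} := range_orderEmbOfFin_compl_initialSeg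
  have hcol : (markedVertex h c).succAbove ∘ e = (markedVertex h r).succAbove ∘ e :=
    funext fun x => by
      have hx : k ≤ (e x).val := hrange.subset (Set.mem_range_self x)
      rw [Function.comp_apply, Function.comp_apply, succAbove_markedVertex_of_le h c hx,
        succAbove_markedVertex_of_le h r hx]
  rw [minor_eq _ rfl rfl, ← he, reducedLaplacian_eq, submatrix_submatrix, hcol,
    markedMinor_self h (Finset.mem_univ 0)]
  refine det_submatrix_eq_det_pinRows _ (Fin.succAbove_right_injective.comp e.injective) fun v => ?_
  rw [Set.range_comp, hrange, image_succAbove_markedVertex, Set.mem_ofPred_eq]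

/-- Up to the swap of `r.succAbove i` and `c.succAbove j`, the rows and columns that remain in the
second factor are the same vertices. -/
theorem secondFactor_reducedLaplacian (r c : Fin (k + 1)) (i j : Fin k) :
    secondFactor (reducedLaplacian h r c) h i j =
      ((pinRows (completeLaplacian (N + 1)) (Finset.univ.map (markedVertex h))).updateRow
        (markedVertex h (c.succAbove j))
        (completeLaplacian (N + 1) (markedVertex h (r.succAbove i)))).det := by
  set u := markedVertex h (r.succAbove i)
  set w := markedVertex h (c.succAbove j) with hw
  rw [secondFactor_eq_det_submatrix]
  set e := (initialSeg k N \ {Fin.castLE h j})ᶜ.orderEmbOfFin rfl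
  have hrange : Set.range e = insert (Fin.castLE h j) {v | k ≤ v.val} :=
    range_orderEmbOfFin_compl_initialSeg_sdiff h j
  have hrow : (markedVertex h r).succAbove ∘ (Equiv.swap (Fin.castLE h i) (Fin.castLE h j) ∘ e) =
      Equiv.swap u w ∘ ((markedVertex h c).succAbove ∘ e) := funext fun x => by
    simp only [Function.comp_apply]
    rcases hrange.subset (Set.mem_range_self x) with hx | hx
    · rw [hx, Equiv.swap_apply_right, markedVertex_succAbove, markedVertex_succAbove, ← hw,
        Equiv.swap_apply_right]
    · have hunmarked (t : Fin (k + 1)) : (e x).succ ≠ markedVertex h t := fun hxt =>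
        (notMem_map_markedVertex h).2 (Nat.succ_le_succ hx)
          (hxt ▸ Finset.mem_map_of_mem _ (Finset.mem_univ t))
      rw [swap_castLE_apply_of_le h i j hx, succAbove_markedVertex_of_le h r hx,
        succAbove_markedVertex_of_le h c hx,
        Equiv.swap_apply_of_ne_of_ne (hunmarked _) (hunmarked _)]
  rw [reducedLaplacian_eq, submatrix_submatrix, hrow]
  refine det_submatrix_swap _ (Fin.succAbove_right_injective.comp e.injective)
    (Finset.mem_map_of_mem _ (Finset.mem_univ _)) fun v => ?_
  rw [Set.range_comp, hrange, Set.image_insert_eq, image_succAbove_markedVertex,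
    markedVertex_succAbove, Set.mem_insert_iff, Set.mem_ofPred_eq, Finset.mem_erase, not_and_or,
    not_not]

theorem secondFactor_reducedLaplacian_of_eq {r c : Fin (k + 1)} {i j : Fin k}
    (hij : r.succAbove i = c.succAbove j) :
    secondFactor (reducedLaplacian h r c) h i j =
      markedMinor h (Finset.univ.erase (c.succAbove j)) c c := by
  have hc : c ∈ Finset.univ.erase (c.succAbove j) :=
    Finset.mem_erase.2 ⟨(Fin.succAbove_ne c j).symm, Finset.mem_univ c⟩
  rw [secondFactor_reducedLaplacian, hij, markedMinor_self h hc, Finset.map_erase, pinRows_erase]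

theorem secondFactor_reducedLaplacian_of_ne {r c : Fin (k + 1)} {i j : Fin k}
    (hij : r.succAbove i ≠ c.succAbove j) :
    secondFactor (reducedLaplacian h r c) h i j =
      -markedMinor h (Finset.univ.erase (r.succAbove i)) (c.succAbove j) (r.succAbove i) := by
  rw [secondFactor_reducedLaplacian, det_pinRows_updateRow_of_ne _
    (Finset.mem_map_of_mem _ (Finset.mem_univ _)) ((markedVertex h).injective.ne hij),
    ← Finset.map_erase]
  rfl

end LaplacianMinors

/-! ### The coefficients of the two sides -/

section Coefficients

variable {m k N : ℕ}

theorem isTransversal_erase_iff_card {A : MarkedPartition m} {u v : Fin m} (huv : u ≠ v)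
    (h : A.part u = A.part v) :
    IsTransversal A (Finset.univ.erase u) ↔ A.parts.card + 1 = m := by
  rw [isTransversal_erase huv h, Fintype.card_fin]

theorem IsPermissible.isTransversal_erase {A B : MarkedPartition m} {c j : Fin m}
    (h : IsPermissible c j (A, B)) : IsTransversal A (Finset.univ.erase j) := by
  obtain ⟨⟨hA, -⟩, l, hl, ⟨hpair, -⟩, -⟩ := h
  have hjl : A.part j = A.part l := by
    rw [A.part_eq_of_mem hpair (by simp), A.part_eq_of_mem hpair (by simp)]
  exact (isTransversal_erase_iff_card hl.symm hjl).2 hA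

theorem isPermissible_iff {A B : MarkedPartition m} {c j l : Fin m}
    (hA : IsTransversal A (Finset.univ.erase j)) (hl : l ≠ j) (hlj : A.part l = A.part j) :
    IsPermissible c j (A, B) ↔
      B.parts.card = 2 ∧ B.part l = B.part c ∧ B.part j ≠ B.part c := by
  constructor
  · rintro ⟨⟨-, hB⟩, l', hl', ⟨hpair, -⟩, p, hp, q, hq, hpq, hjp, hcq, hlq⟩
    have hl'j : A.part l' = A.part j := by
      rw [A.part_eq_of_mem hpair (by simp), A.part_eq_of_mem hpair (by simp)]
    obtain rfl := hA.eq_of_part_eq hl' hl (hl'j.trans hlj.symm)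
    rw [B.part_eq_of_mem hp hjp, B.part_eq_of_mem hq hcq, B.part_eq_of_mem hq hlq]
    exact ⟨hB, rfl, hpq⟩
  · rintro ⟨hB, hlc, hjc⟩
    refine ⟨⟨(isTransversal_erase_iff_card hl.symm hlj.symm).1 hA, hB⟩, l, hl, ⟨?_, ?_⟩,
      B.part j, part_mem_parts B j, B.part c, part_mem_parts B c, hjc,
      mem_part_iff.2 rfl, mem_part_iff.2 rfl, mem_part_iff.2 hlc⟩
    · exact hA.part_eq_pair hl hlj ▸ part_mem_parts A j
    · exact fun v hvj hvl => hA.part_eq_singleton hl hlj hvj hvl ▸ part_mem_parts A v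

/-- The coefficients of `det (M_{[k]∖{i},[k]∖{j'}})`, where `u` is the marked vertex indexing row
`i` of `M = L_{r,c}` and `j` the one indexing column `j'`. -/
def secondCoeff (c j u : Fin m) : MarkedPartition m → ℤ :=
  if u = j then rootedCoeff (Finset.univ.erase j) c c else -rootedCoeff (Finset.univ.erase u) j u

/-- The coefficients, up to sign, of `det (M_{i,j'})`, where `u` is the marked vertex indexing row
`i` of `M = L_{r,c}` and `j` the one indexing column `j'`. -/
def firstCoeff (r c j u : Fin m) : MarkedPartition m → ℤ :=
  rootedCoeff {r, u} r c - rootedCoeff {r, u} r j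

theorem secondCoeff_of_isTransversal {A : MarkedPartition m} {c j l : Fin m}
    (hA : IsTransversal A (Finset.univ.erase j)) (hl : l ≠ j) (hlj : A.part l = A.part j)
    (u : Fin m) :
    secondCoeff c j u A = (if u = j then 1 else 0) - if u = l then 1 else 0 := by
  obtain rfl | hu := eq_or_ne u j
  · simp [secondCoeff, rootedCoeff, hA, hl.symm]
  have hul : IsTransversal A (Finset.univ.erase u) ∧ A.part u = A.part j ↔ u = l := by
    refine ⟨fun h => hA.eq_of_part_eq hu hl (h.2.trans hlj.symm), ?_⟩
    rintro rfl
    exact ⟨(isTransversal_erase_iff_card hu hlj).2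
      ((isTransversal_erase_iff_card hu.symm hlj.symm).1 hA), hlj⟩
  simp [secondCoeff, rootedCoeff, hu, hul]

theorem secondCoeff_eq_zero {A : MarkedPartition m} {j : Fin m}
    (hA : ¬ IsTransversal A (Finset.univ.erase j)) (c u : Fin m) : secondCoeff c j u A = 0 := by
  obtain rfl | hu := eq_or_ne u j
  · simp [secondCoeff, rootedCoeff, hA]
  have hAu : ¬ (IsTransversal A (Finset.univ.erase u) ∧ A.part u = A.part j) := fun h =>
    hA ((isTransversal_erase_iff_card hu.symm h.2.symm).2
      ((isTransversal_erase_iff_card hu h.2).1 h.1))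
  simp [secondCoeff, rootedCoeff, hu, hAu]

theorem firstCoeff_of_ne {r u : Fin m} (hru : r ≠ u) (c j : Fin m) (B : MarkedPartition m) :
    firstCoeff r c j u B = (if B.parts.card = 2 ∧ B.part r ≠ B.part u then 1 else 0) *
      ((if B.part c = B.part r then 1 else 0) - if B.part j = B.part r then 1 else 0) := by
  simp only [firstCoeff, Pi.sub_apply, rootedCoeff, isTransversal_pair hru, mul_sub, ite_and,
    ite_mul, one_mul, zero_mul]

/-- Both sides are `0` unless `A` pairs `j` with some `l`; the sum then reduces to the difference of
its terms `u = j` and `u = l`, and at most one of the two is nonzero. -/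
theorem sum_secondCoeff_mul_firstCoeff (r c j : Fin (k + 1)) (A B : MarkedPartition (k + 1)) :
    ∑ i, secondCoeff c j (r.succAbove i) A * firstCoeff r c j (r.succAbove i) B =
      permissibleSum c j (A, B) := by
  classical
  let t (u : Fin (k + 1)) : ℤ := (if B.parts.card = 2 ∧ B.part r ≠ B.part u then 1 else 0) *
    ((if B.part c = B.part r then 1 else 0) - if B.part j = B.part r then 1 else 0)
  have htr : t r = 0 := by simp [t]
  have hsum : ∑ i, secondCoeff c j (r.succAbove i) A * firstCoeff r c j (r.succAbove i) B =
      ∑ u, secondCoeff c j u A * t u := by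
    rw [Fin.sum_univ_succAbove _ r, htr, mul_zero, zero_add]
    exact Finset.sum_congr rfl fun i _ => by rw [firstCoeff_of_ne (Fin.succAbove_ne r i).symm]
  rw [hsum, permissibleSum]
  by_cases hA : IsTransversal A (Finset.univ.erase j)
  · obtain ⟨l, hl, hlj⟩ := hA.exists_part_eq
    have hterms : ∑ u, secondCoeff c j u A * t u = t j - t l := by
      simp only [secondCoeff_of_isTransversal hA hl hlj, sub_mul, Finset.sum_sub_distrib, ite_mul,
        one_mul, zero_mul, Finset.sum_ite_eq', Finset.mem_univ, if_true]
    rw [hterms, isPermissible_iff hA hl hlj]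
    by_cases hB : B.parts.card = 2
    · simp only [t, hB, true_and, ne_eq, part_eq_part_iff_of_card_eq_two hB _ c r,
        eq_comm (a := B.part r)]
      by_cases hc : B.part c = B.part r <;> by_cases hj : B.part j = B.part r <;>
        by_cases hl : B.part l = B.part r <;> simp [hc, hj, hl]
    · simp [t, hB]
  · rw [if_neg fun h => hA h.isTransversal_erase]
    exact Finset.sum_eq_zero fun u _ => by rw [secondCoeff_eq_zero hA, zero_mul]

theorem isForestExpansion_secondFactor (h : k ≤ N) (r c : Fin (k + 1)) (i j : Fin k) :
    IsForestExpansion (Nat.succ_le_succ h) (secondCoeff c (c.succAbove j) (r.succAbove i))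
      (secondFactor (reducedLaplacian h r c) h i j) := by
  by_cases hij : r.succAbove i = c.succAbove j
  · rw [secondFactor_reducedLaplacian_of_eq h hij, secondCoeff, if_pos hij]
    exact isForestExpansion_markedMinor h
      (Finset.mem_erase.2 ⟨(Fin.succAbove_ne c j).symm, Finset.mem_univ c⟩) c
  · have hneg := (isForestExpansion_markedMinor h
      (Finset.mem_erase.2 ⟨Ne.symm hij, Finset.mem_univ (c.succAbove j)⟩)
      (r.succAbove i)).smul (-1)
    rw [neg_one_smul, MvPolynomial.C_neg, MvPolynomial.C_1, neg_one_mul] at hneg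
    rwa [secondFactor_reducedLaplacian_of_ne h hij, secondCoeff, if_neg hij]

theorem isForestExpansion_firstFactor (h : k ≤ N) (r c : Fin (k + 1)) (i j : Fin k) :
    IsForestExpansion (Nat.succ_le_succ h)
      ((-1 : ℤ) ^ (i.val + j.val + (r.val + c.val)) •
        firstCoeff r c (c.succAbove j) (r.succAbove i))
      (firstFactor (reducedLaplacian h r c) h i j) := by
  rw [firstFactor_reducedLaplacian]
  have hr : r ∈ ({r, r.succAbove i} : Finset (Fin (k + 1))) := Finset.mem_insert_self _ _
  exact ((isForestExpansion_markedMinor h hr c).sub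
    (isForestExpansion_markedMinor h hr (c.succAbove j))).smul _

theorem sum_pairProduct_secondCoeff_firstCoeff (r c : Fin (k + 1)) (j : Fin k) :
    ∑ i : Fin k, (-1 : ℤ) ^ (i.val + j.val) •
      pairProduct (secondCoeff c (c.succAbove j) (r.succAbove i))
        ((-1 : ℤ) ^ (i.val + j.val + (r.val + c.val)) •
          firstCoeff r c (c.succAbove j) (r.succAbove i)) =
      (-1 : ℤ) ^ (r.val + c.val) • permissibleSum c (c.succAbove j) := by
  funext ⟨A, B⟩
  rw [Pi.smul_apply, ← sum_secondCoeff_mul_firstCoeff r, smul_eq_mul, Finset.mul_sum,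
    Finset.sum_apply]
  refine Finset.sum_congr rfl fun i _ => ?_
  have hsign : (-1 : ℤ) ^ (i.val + j.val) * (-1) ^ (i.val + j.val) = 1 := by
    rw [← mul_pow, neg_one_mul, neg_neg, one_pow]
  simp only [Pi.smul_apply, pairProduct, smul_eq_mul]
  rw [pow_add (-1 : ℤ) (i.val + j.val)]
  linear_combination ((-1) ^ (r.val + c.val) *
    secondCoeff c (c.succAbove j) (r.succAbove i) A *
    firstCoeff r c (c.succAbove j) (r.succAbove i) B) * hsign

theorem isRightSide_iff (h : k ≤ N) (r c : Fin (k + 1)) (j : Fin k) (S : PairSum (k + 1)) :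
    IsRightSide h r c j S ↔
      S = (-1 : ℤ) ^ (r.val + c.val) • permissibleSum c (c.succAbove j) := by
  rw [← sum_pairProduct_secondCoeff_firstCoeff]
  constructor
  · rintro ⟨α, β, hα, hβ, rfl⟩
    refine Finset.sum_congr rfl fun i _ => ?_
    rw [(hα i).unique (isForestExpansion_secondFactor h r c i j),
      (hβ i).unique (isForestExpansion_firstFactor h r c i j)]
  · rintro rfl
    exact ⟨_, _, fun i => isForestExpansion_secondFactor h r c i j,
      fun i => isForestExpansion_firstFactor h r c i j, rfl⟩

theorem part_onePart (u : Fin (k + 1)) : (onePart k).part u = Finset.univ :=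
  Finset.mem_singleton.1 (part_mem_parts (onePart k) u)

theorem part_allSingletons (u : Fin m) : (allSingletons m).part u = {u} :=
  Finpartition.part_eq_of_mem _ (Finpartition.mem_bot_iff.2 ⟨u, Finset.mem_univ u, rfl⟩)
    (Finset.mem_singleton_self u)

theorem isTransversal_singleton_iff_eq_onePart {A : MarkedPartition (k + 1)} {r : Fin (k + 1)} :
    IsTransversal A {r} ↔ A = onePart k := by
  rw [isTransversal_singleton]
  constructor
  · exact fun h => eq_of_part_eq_part_iff fun u v =>
      iff_of_true ((h u).trans (h v).symm) ((part_onePart u).trans (part_onePart v).symm)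
  · rintro rfl u
    rw [part_onePart, part_onePart]

theorem isTransversal_univ_iff_eq_allSingletons {B : MarkedPartition m} :
    IsTransversal B Finset.univ ↔ B = allSingletons m := by
  have hinj : Function.Injective (allSingletons m).part := fun u v huv =>
    Finset.singleton_injective (by rwa [part_allSingletons, part_allSingletons] at huv)
  rw [isTransversal_univ]
  constructor
  · exact fun h => eq_of_part_eq_part_iff fun u v => h.eq_iff.trans hinj.eq_iff.symm
  · rintro rfl
    exact hinj

theorem pairProduct_rootedCoeff_singleton_univ (r c : Fin (k + 1)) :
    pairProduct (rootedCoeff {r} r c) (rootedCoeff Finset.univ 0 0) = leftMonomial k := by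
  funext ⟨A, B⟩
  have hA : IsTransversal A {r} ∧ A.part c = A.part r ↔ A = onePart k := by
    rw [← isTransversal_singleton_iff_eq_onePart (r := r), and_iff_left_iff_imp,
      isTransversal_singleton]
    exact fun h => h c
  simp only [pairProduct, rootedCoeff, leftMonomial, hA, isTransversal_univ_iff_eq_allSingletons,
    and_true, Prod.mk.injEq, ite_and, ite_mul, one_mul, zero_mul]

theorem isLeftSide_iff (h : k ≤ N) (r c : Fin (k + 1)) (T : PairSum (k + 1)) :
    IsLeftSide h r c T ↔ T = (-1 : ℤ) ^ (r.val + c.val) • leftMonomial k := by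
  have hdet : IsForestExpansion (Nat.succ_le_succ h)
      ((-1 : ℤ) ^ (r.val + c.val) • rootedCoeff {r} r c) (reducedLaplacian h r c).det := by
    rw [det_reducedLaplacian]
    exact (isForestExpansion_markedMinor h (Finset.mem_singleton_self r) c).smul _
  have hminor : IsForestExpansion (Nat.succ_le_succ h) (rootedCoeff Finset.univ 0 0)
      (minor (reducedLaplacian h r c) (initialSeg k N) (initialSeg k N)) := by
    rw [minor_initialSeg_reducedLaplacian]
    exact isForestExpansion_markedMinor h (Finset.mem_univ 0) 0
  have hproduct : pairProduct ((-1 : ℤ) ^ (r.val + c.val) • rootedCoeff {r} r c)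
      (rootedCoeff Finset.univ 0 0) = (-1 : ℤ) ^ (r.val + c.val) • leftMonomial k := by
    rw [← pairProduct_rootedCoeff_singleton_univ r c]
    exact funext fun AB => mul_assoc _ _ _
  rw [← hproduct]
  constructor
  · rintro ⟨α, β, hα, hβ, rfl⟩
    rw [hα.unique hdet, hβ.unique hminor]
  · rintro rfl
    exact ⟨_, _, hdet, hminor, rfl⟩

end Coefficients

/-! ### The identity between spanning forest polynomials -/

section Identities

variable {k m n N : ℕ}

theorem IsForestExpansion.mul {h : m ≤ n} {α β : MarkedPartition m → ℤ}
    {p q : MvPolynomial (Sym2 (Fin n)) ℤ} (hα : IsForestExpansion h α p)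
    (hβ : IsForestExpansion h β q) :
    p * q = ∑ AB : MarkedPartition m × MarkedPartition m,
      MvPolynomial.C (pairProduct α β AB) * (forestSum h AB.1 * forestSum h AB.2) := by
  rw [hα, hβ, Finset.sum_mul_sum, Fintype.sum_prod_type]
  refine Finset.sum_congr rfl fun A _ => Finset.sum_congr rfl fun B _ => ?_
  rw [pairProduct, MvPolynomial.C_mul]
  ring

theorem IsLeftSide.eq_sum {h : k ≤ N} {r c : Fin (k + 1)} {T : PairSum (k + 1)}
    (hT : IsLeftSide h r c T) :
    (reducedLaplacian h r c).det *
        minor (reducedLaplacian h r c) (initialSeg k N) (initialSeg k N) =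
      ∑ AB, MvPolynomial.C (T AB) *
        (forestSum (Nat.succ_le_succ h) AB.1 * forestSum (Nat.succ_le_succ h) AB.2) := by
  obtain ⟨α, β, hα, hβ, rfl⟩ := hT
  exact hα.mul hβ

theorem IsRightSide.eq_sum {h : k ≤ N} {r c : Fin (k + 1)} {j : Fin k} {S : PairSum (k + 1)}
    (hS : IsRightSide h r c j S) :
    ∑ i : Fin k, (-1) ^ (i.val + j.val) *
        (secondFactor (reducedLaplacian h r c) h i j *
          firstFactor (reducedLaplacian h r c) h i j) =
      ∑ AB, MvPolynomial.C (S AB) *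
        (forestSum (Nat.succ_le_succ h) AB.1 * forestSum (Nat.succ_le_succ h) AB.2) := by
  obtain ⟨α, β, hα, hβ, rfl⟩ := hS
  simp only [(hα _).mul (hβ _), Finset.mul_sum, Finset.sum_apply, Pi.smul_apply, smul_eq_mul,
    map_sum, map_mul, map_pow, map_neg, map_one, Finset.sum_mul, mul_assoc]
  exact Finset.sum_comm

theorem forestSum_mul_forestSum (h : k ≤ N) (c : Fin (k + 1)) (j : Fin k) :
    forestSum (Nat.succ_le_succ h) (onePart k) *
        forestSum (Nat.succ_le_succ h) (allSingletons (k + 1)) =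
      ∑ AB : MarkedPartition (k + 1) × MarkedPartition (k + 1),
        MvPolynomial.C (permissibleSum c (c.succAbove j) AB) *
          (forestSum (Nat.succ_le_succ h) AB.1 * forestSum (Nat.succ_le_succ h) AB.2) := by
  have hsign : (-1 : ℤ) ^ (c.val + c.val) = 1 := (Even.add_self c.val).neg_one_pow
  have hleft : IsLeftSide h c c (leftMonomial k) :=
    (isLeftSide_iff h c c _).2 (by rw [hsign, one_smul])
  have hright : IsRightSide h c c j (permissibleSum c (c.succAbove j)) :=
    (isRightSide_iff h c c j _).2 (by rw [hsign, one_smul])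
  rw [← hright.eq_sum, ← det_mul_minor_initialSeg, hleft.eq_sum]
  simp only [leftMonomial, apply_ite MvPolynomial.C, map_one, map_zero, ite_mul, one_mul,
    zero_mul, Finset.sum_ite_eq', Finset.mem_univ, if_true]

open Classical in
/-- Replacing `a_e` by `a_e⁻¹` for the edges of `G` and by `0` for all other edges, and multiplying
by the product of the edges of `G`, turns `forestSum` into `spanningForestPoly`. -/
theorem map_spanningForestPoly (h : m ≤ n) (G : SimpleGraph (Fin n))
    (P : MarkedPartition m) {K : Type*} [Field K] (f : MvPolynomial (Sym2 (Fin n)) ℤ →+* K)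
    (hf : ∀ e, f (MvPolynomial.X e) ≠ 0) {g : MvPolynomial (Sym2 (Fin n)) ℤ →+* K}
    (hg : ∀ e, g (MvPolynomial.X e) =
      if e ∈ G.edgeFinset then (f (MvPolynomial.X e))⁻¹ else 0) :
    f (spanningForestPoly h G P) =
      (∏ e ∈ G.edgeFinset, f (MvPolynomial.X e)) * g (forestSum h P) := by
  have hmem {F : Finset (Sym2 (Fin n))} :
      F ∈ compatibleForests h G P ↔ F ⊆ G.edgeFinset ∧ IsCompatibleForest h P F :=
    Finset.mem_filter.trans (and_congr_left' Finset.mem_powerset)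
  have hsub : compatibleForests h G P ⊆ compatibleForests h ⊤ P := fun F hF =>
    mem_compatibleForests_top.2
      ⟨fun e he => G.not_isDiag_of_mem_edgeFinset ((hmem.1 hF).1 he), (hmem.1 hF).2⟩
  have hinside : ∀ F ∈ compatibleForests h G P, f (∏ e ∈ G.edgeFinset \ F, MvPolynomial.X e) =
      (∏ e ∈ G.edgeFinset, f (MvPolynomial.X e)) * g (∏ e ∈ F, MvPolynomial.X e) := by
    intro F hF
    have hFG : F ⊆ G.edgeFinset := (hmem.1 hF).1
    have hinv : g (∏ e ∈ F, MvPolynomial.X e) = (∏ e ∈ F, f (MvPolynomial.X e))⁻¹ := by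
      rw [map_prod, ← Finset.prod_inv_distrib]
      exact Finset.prod_congr rfl fun e he => by rw [hg, if_pos (hFG he)]
    rw [hinv, map_prod, eq_mul_inv_iff_mul_eq₀ (Finset.prod_ne_zero_iff.2 fun e _ => hf e)]
    exact Finset.prod_sdiff hFG
  have houtside : ∀ F ∈ compatibleForests h ⊤ P, F ∉ compatibleForests h G P →
      g (∏ e ∈ F, MvPolynomial.X e) = 0 := by
    intro F hF hFG
    obtain ⟨e, heF, heG⟩ := Finset.not_subset.1 fun hsubset =>
      hFG (hmem.2 ⟨hsubset, (mem_compatibleForests_top.1 hF).2⟩)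
    rw [map_prod]
    exact Finset.prod_eq_zero heF (by rw [hg, if_neg heG])
  rw [forestSum, map_sum, ← Finset.sum_subset hsub houtside, spanningForestPoly, map_sum,
    Finset.mul_sum]
  exact Finset.sum_congr rfl hinside

theorem spanningForestPoly_mul_spanningForestPoly (h : k ≤ N) (c : Fin (k + 1)) (j : Fin k)
    (G : SimpleGraph (Fin (N + 1))) :
    spanningForestPoly (Nat.succ_le_succ h) G (onePart k) *
        spanningForestPoly (Nat.succ_le_succ h) G (allSingletons (k + 1)) =
      ∑ AB : MarkedPartition (k + 1) × MarkedPartition (k + 1),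
        MvPolynomial.C (permissibleSum c (c.succAbove j) AB) *
          (spanningForestPoly (Nat.succ_le_succ h) G AB.1 *
            spanningForestPoly (Nat.succ_le_succ h) G AB.2) := by
  classical
  let K := FractionRing (MvPolynomial (Sym2 (Fin (N + 1))) ℤ)
  let f : MvPolynomial (Sym2 (Fin (N + 1))) ℤ →+* K := algebraMap _ _
  have hinj : Function.Injective f := IsFractionRing.injective _ _
  have hf (e : Sym2 (Fin (N + 1))) : f (MvPolynomial.X e) ≠ 0 :=
    (map_ne_zero_iff f hinj).2 (MvPolynomial.X_ne_zero e)
  let g : MvPolynomial (Sym2 (Fin (N + 1))) ℤ →+* K :=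
    MvPolynomial.eval₂Hom (Int.castRingHom K)
      fun e => if e ∈ G.edgeFinset then (f (MvPolynomial.X e))⁻¹ else 0
  have hmap := fun P => map_spanningForestPoly (Nat.succ_le_succ h) G P f hf (g := g)
    fun e => MvPolynomial.eval₂Hom_X' _ _ e
  have hC (z : ℤ) : f (MvPolynomial.C z) = g (MvPolynomial.C z) :=
    RingHom.congr_fun (RingHom.ext_int (f.comp MvPolynomial.C) (g.comp MvPolynomial.C)) z
  have hforest := congrArg g (forestSum_mul_forestSum h c j)
  apply hinj
  simp only [map_mul, map_sum, hmap, hC] at hforest ⊢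
  rw [mul_mul_mul_comm, hforest, Finset.mul_sum]
  exact Finset.sum_congr rfl fun AB _ => by ring

end Identities
end ColumnExpansion

end

open ColumnExpansion in
theorem lemma2p5 (k N : ℕ) (h : k ≤ N) (c : Fin (k + 1)) (j : Fin k) :
    -- the right hand side for `r = c` is one copy of each permissible monomial
    (∀ S : PairSum (k + 1),
      IsRightSide h c c j S ↔ S = permissibleSum c (c.succAbove j)) ∧
    -- for any removed row `r`, both sides only change by the common sign `(-1)^(r+c)`
    (∀ (r : Fin (k + 1)) (S : PairSum (k + 1)),
      IsRightSide h r c j S ↔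
        S = (-1 : ℤ) ^ (r.val + c.val) • permissibleSum c (c.succAbove j)) ∧
    (∀ (r : Fin (k + 1)) (T : PairSum (k + 1)),
      IsLeftSide h r c T ↔ T = (-1 : ℤ) ^ (r.val + c.val) • leftMonomial k) ∧
    -- the resulting identity of spanning forest polynomials holds on every graph
    (∀ G : SimpleGraph (Fin (N + 1)),
      spanningForestPoly (Nat.succ_le_succ h) G (onePart k) *
          spanningForestPoly (Nat.succ_le_succ h) G (allSingletons (k + 1)) =
        ∑ AB : MarkedPartition (k + 1) × MarkedPartition (k + 1),
          MvPolynomial.C (permissibleSum c (c.succAbove j) AB) *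
            (spanningForestPoly (Nat.succ_le_succ h) G AB.1 *
              spanningForestPoly (Nat.succ_le_succ h) G AB.2)) := by
  have hsign : (-1 : ℤ) ^ (c.val + c.val) = 1 := by rw [← two_mul]; simp
  refine ⟨fun S => ?_, fun r S => isRightSide_iff h r c j S, fun r T => isLeftSide_iff h r c T,
    fun G => spanningForestPoly_mul_spanningForestPoly h c j G⟩
  rw [isRightSide_iff, hsign, one_smul]
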